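/- Let $(\Omega_1,\mathcal A_1,Q_1)$ and $(\Omega_2,\mathcal A_2,Q_2)$ be probability spaces, and let $P=Q_1\otimes Q_2$ on $\Omega_1\times\Omega_2$. For $n\in\mathbb N$ let $\mathbf X_n:\Omega_1\to\chi_{1n}$ (the data) be an arbitrary map into a set, and let $\mathbf M_n:\Omega_2\to\chi_{2n}$ (the random permutation, or other resampling randomness) be a measurable map into a measurable space. Let $\boldsymbol\Sigma,\boldsymbol\Sigma^\pi\in\mathbb R^{r\times r}$ be symmetric positive semidefinite. *Conditional weak convergence.* For maps $\mathbf Y_n:\Omega_1\times\Omega_2\to\mathbb R^r$ that are measurable in $\omega_2$ for fixed $\omega_1$, and a random vector $\mathbf Z$, write $\mathbf Y_n\xrightarrow{d^*}\mathbf Z$ if, as $n\to\infty$, in outer $Q_1$-probability, $$\sup_{h\in BL_1(\mathbb R^r)}\Big|\int h(\mathbf Y_n)\,dQ_2-\mathrm E\,h(\mathbf Z)\Big|\to0\quad\text{and}\quad \int h(\mathbf Y_n)^*\,dQ_2-\int h(\mathbf Y_n)_*\,dQ_2\to 0\ \text{ for every } h\in BL_1(\mathbb R^r),$$ where $BL_1(\mathbb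 R^r)$ is the set of functions $h:\mathbb R^r\to[-1,1]$ with $|h(x)-h(y)|\le\|x-y\|$, and $^*$, $_*$ denote the minimal measurable majorant and the maximal measurable minorant with respect to $P$. A sequence of maps $\mathbf V_n$ from a probability space into a metric space is *asymptotically measurable* if $\mathrm E^*f(\mathbf V_n)-\mathrm E_*f(\mathbf V_n)\to0$ for every bounded continuous $f$, where $\mathrm E^*$ and $\mathrm E_*$ are outer and inner expectation. *Estimators.* Let $\widehat{\boldsymbol\theta}^\pi$ (with values in $\mathbb R^r$) and $\widehat{\boldsymbol\Sigma}^\pi$ be functions of $(\mathbf X_n,\mathbf M_n)$, and let $\widehat{\boldsymbol\Sigma}$ be a function of $\mathbf X_n$, where $\widehat{\boldsymbol\Sigma},\widehat{\boldsymbol\Sigma}^\pi$ are symmetric positive semidefinite $r\times r$ matrices. Let $$\boldsymbol\Sigma^\pi=\mathbf U^\pi\mathbf D^\pi\mathbf U^{\pi\prime},\qquad \widehat{\boldsymbol\Sigma}=\widehat{\mathbf U}\widehat{\mathbf D}\widehat{\mathbf U}',\qquad \widehat{\boldsymbol\Sigma}^\pi=\widehat{\mathbf U}^\pi\widehat{\mathbf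 D}^\pi\widehat{\mathbf U}^{\pi\prime}$$ be eigenvalue decompositions with orthogonal $\mathbf U^\pi,\widehat{\mathbf U},\widehat{\mathbf U}^\pi$ and diagonal $\mathbf D^\pi,\widehat{\mathbf D},\widehat{\mathbf D}^\pi$ with decreasing diagonal entries, where $\widehat{\mathbf U},\widehat{\mathbf D}$ are functions of $\mathbf X_n$ and $\widehat{\mathbf U}^\pi,\widehat{\mathbf D}^\pi$ are functions of $(\mathbf X_n,\mathbf M_n)$. Let $R_1,\dots,R_r$ be i.i.d. Rademacher random variables on $\Omega_2$ (so $Q_2(R_i=1)=Q_2(R_i=-1)=\tfrac12$), independent of $\mathbf M_n$ for each $n$ (and, living on $\Omega_2$, of the data), let $\mathbf R=\mathrm{diag}(R_1,\dots,R_r)$, and put $$\widetilde{\boldsymbol\theta}^\pi=\widehat{\mathbf U}\widehat{\mathbf D}^{1/2}\big((\widehat{\mathbf D}^\pi)^{1/2}\big)^+\mathbf R\,\widehat{\mathbf U}^{\pi\prime}\,\widehat{\boldsymbol\theta}^\pi,$$ where $^+$ is the Moore–Penrose inverse. For every fixed value of the data, $\widehat{\boldsymbol\theta}^\pi$ and $\widehat{\mathbf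 U}^\pi$ are measurable functions of $\mathbf M_n$, and $\widetilde{\boldsymbol\theta}^\pi$ is a measurable function on $\Omega_2$. Assume: 1. $\sqrt n\,\widehat{\boldsymbol\theta}^\pi\xrightarrow{d^*}\mathcal N_r(\mathbf 0,\boldsymbol\Sigma^\pi)$; 2. $\widehat{\boldsymbol\Sigma}\to\boldsymbol\Sigma$ and $\widehat{\boldsymbol\Sigma}^\pi\to\boldsymbol\Sigma^\pi$ in outer probability; 3. $\mathrm{rank}(\boldsymbol\Sigma)\le\mathrm{rank}(\boldsymbol\Sigma^\pi)=:\widetilde r$; 4. the inner probability of $\min\{\mathrm{rank}(\widehat{\boldsymbol\Sigma}),\mathrm{rank}(\widehat{\boldsymbol\Sigma}^\pi)\}\le\widetilde r$ tends to $1$; 5. the positive eigenvalues of $\boldsymbol\Sigma^\pi$ are distinct, i.e. $\mathbf D^\pi_{11}>\dots>\mathbf D^\pi_{\widetilde r\widetilde r}$; 6. $\widehat{\mathbf U}$ and $\widehat{\mathbf U}^\pi$ are asymptotically measurable. Then $\sqrt n\,\widetilde{\boldsymbol\theta}^\pi\xrightarrow{d^*}\mathcal N_r(\mathbf 0,\boldsymbol\Sigma)$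 as $n\to\infty$. -/

import Mathlib

open MeasureTheory ProbabilityTheory Filter Topology
open scoped ENNReal BoundedContinuousFunction

namespace PermCorr

/-! ### Measurable majorants, outer expectations, modes of convergence

Mathlib evaluates a measure on a set that need not be measurable as the outer measure of that set,
so `μ A` is the outer probability of `A`, and `TendstoInMeasure` is convergence in outer
probability. -/

section Outer

variable {Ω : Type*} [MeasurableSpace Ω]

/-- `U` is a minimal measurable majorant of `T`. -/
structure IsMinMeasurableMajorant (P : Measure Ω) (T U : Ω → ℝ) : Prop where
  measurable : Measurable U
  le : ∀ ω, T ω ≤ U ω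
  ae_le : ∀ V : Ω → ℝ, Measurable V → (∀ᵐ ω ∂P, T ω ≤ V ω) → ∀ᵐ ω ∂P, U ω ≤ V ω

/-- Every bounded function has a minimal measurable majorant. -/
theorem exists_isMinMeasurableMajorant (P : Measure Ω) [IsFiniteMeasure P] (T : Ω → ℝ) (C : ℝ)
    (hT : ∀ ω, |T ω| ≤ C) : ∃ U, IsMinMeasurableMajorant P T U := by
  obtain ⟨g, hgm, hgf, hgi⟩ :=
    exists_measurable_le_lintegral_eq (μ := P) (fun ω => ENNReal.ofReal (C - T ω))
  have hfin : ∫⁻ ω, g ω ∂P ≠ ∞ := by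
    have h1 : ∫⁻ ω, g ω ∂P ≤ ∫⁻ _, ENNReal.ofReal (2 * C) ∂P := by
      refine lintegral_mono fun ω => (hgf ω).trans (ENNReal.ofReal_le_ofReal ?_)
      have := abs_le.1 (hT ω)
      linarith
    refine ne_top_of_le_ne_top ?_ h1
    rw [lintegral_const]
    exact ENNReal.mul_ne_top ENNReal.ofReal_ne_top (measure_ne_top P _)
  refine ⟨fun ω => C - (g ω).toReal, measurable_const.sub hgm.ennreal_toReal, ?_, ?_⟩
  · intro ω
    have h0 : 0 ≤ C - T ω := by linarith [(abs_le.1 (hT ω)).2]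
    have h1 := ENNReal.toReal_mono ENNReal.ofReal_ne_top (hgf ω)
    rw [ENNReal.toReal_ofReal h0] at h1
    linarith
  · intro V hV hTV
    have hk : Measurable fun ω => max (g ω) (ENNReal.ofReal (C - V ω)) :=
      hgm.max (measurable_const.sub hV).ennreal_ofReal
    have hle : ∫⁻ ω, max (g ω) (ENNReal.ofReal (C - V ω)) ∂P ≤ ∫⁻ ω, g ω ∂P := by
      rw [← hgi]
      refine lintegral_mono_ae ?_
      filter_upwards [hTV] with ω hω
      exact max_le (hgf ω) (ENNReal.ofReal_le_ofReal (by linarith))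
    have heq := ae_eq_of_ae_le_of_lintegral_le
      (ae_of_all P fun ω => le_max_left (g ω) (ENNReal.ofReal (C - V ω))) hfin hk.aemeasurable hle
    filter_upwards [heq] with ω hω
    have h1 : ENNReal.ofReal (C - V ω) ≤ g ω := by
      rw [hω]; exact le_max_right _ _
    have h2 : g ω ≠ ∞ := ne_top_of_le_ne_top ENNReal.ofReal_ne_top (hgf ω)
    have h3 := (ENNReal.ofReal_le_iff_le_toReal h2).1 h1
    linarith

open Classical in
/-- The minimal measurable majorant `T^*` (unique up to null sets), as a fixed version. -/
noncomputable def majorant (P : Measure Ω) (T : Ω → ℝ) : Ω → ℝ :=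
  if h : ∃ U, IsMinMeasurableMajorant P T U then h.choose else 0

/-- The maximal measurable minorant `T_* = -(-T)^*`. -/
noncomputable def minorant (P : Measure Ω) (T : Ω → ℝ) : Ω → ℝ :=
  fun ω => -majorant P (fun ω' => -T ω') ω

theorem majorant_spec (P : Measure Ω) [IsFiniteMeasure P] (T : Ω → ℝ) (C : ℝ)
    (hT : ∀ ω, |T ω| ≤ C) : IsMinMeasurableMajorant P T (majorant P T) := by
  have h := exists_isMinMeasurableMajorant P T C hT
  unfold majorant
  rw [dif_pos h]
  exact h.choose_spec

/-- Outer expectation `E^* T = inf {E U : U ≥ T measurable, E U exists}` of a bounded map `T`. -/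
noncomputable def outerExp (P : Measure Ω) (T : Ω → ℝ) : ℝ :=
  sInf {x | ∃ U : Ω → ℝ, Measurable U ∧ Integrable U P ∧ (∀ ω, T ω ≤ U ω) ∧ x = ∫ ω, U ω ∂P}

/-- Inner expectation `E_* T = -E^*(-T)` of a bounded map `T`. -/
noncomputable def innerExp (P : Measure Ω) (T : Ω → ℝ) : ℝ :=
  -outerExp P (fun ω => -T ω)

/-- Inner probability `P_*(A) = 1 - P^*(Aᶜ)`. -/
noncomputable def innerProb (P : Measure Ω) (A : Set Ω) : ℝ≥0∞ := 1 - P Aᶜ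

/-- Asymptotic measurability: `E^* f(Y_n) - E_* f(Y_n) → 0` for all bounded continuous `f`. -/
def AsympMeasurable {E : Type*} [TopologicalSpace E] (P : Measure Ω) (Y : ℕ → Ω → E) : Prop :=
  ∀ f : E →ᵇ ℝ,
    Tendsto (fun n => outerExp P (fun ω => f (Y n ω)) - innerExp P (fun ω => f (Y n ω)))
      atTop (𝓝 0)

end Outer

/-- Real functions on `E` with bounded-Lipschitz norm at most one. -/
def BL1 (E : Type*) [PseudoMetricSpace E] : Set (E → ℝ) :=
  {h | (∀ x, |h x| ≤ 1) ∧ ∀ x y, |h x - h y| ≤ dist x y}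

/-- Conditional weak convergence in outer probability to the law `ν`: the data live on `(Ω₁, Q₁)`,
the additional randomness on `(Ω₂, Q₂)`. The bounded-Lipschitz distance between the conditional law
and `ν` tends to zero in outer `Q₁`-probability, and the conditional expectations of the measurable
majorant and minorant (with respect to both sources of randomness jointly) merge. -/
def CondWeakConv {Ω₁ Ω₂ E : Type*} [MeasurableSpace Ω₁] [MeasurableSpace Ω₂]
    [PseudoMetricSpace E] [MeasurableSpace E] (Q₁ : Measure Ω₁) (Q₂ : Measure Ω₂)
    (Y : ℕ → Ω₁ → Ω₂ → E) (ν : Measure E) : Prop :=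
  TendstoInMeasure Q₁
      (fun n ω₁ => ⨆ h : BL1 E, |∫ ω₂, h.1 (Y n ω₁ ω₂) ∂Q₂ - ∫ z, h.1 z ∂ν|)
      atTop (fun _ => (0 : ℝ)) ∧
  ∀ h ∈ BL1 E,
    TendstoInMeasure Q₁
      (fun n ω₁ =>
        ∫ ω₂, majorant (Q₁.prod Q₂) (fun p => h (Y n p.1 p.2)) (ω₁, ω₂) ∂Q₂ -
        ∫ ω₂, minorant (Q₁.prod Q₂) (fun p => h (Y n p.1 p.2)) (ω₁, ω₂) ∂Q₂)
      atTop (fun _ => (0 : ℝ))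

/-! ### Matrices -/

section Matrices

variable {r : ℕ}

/-- The spectral norm of a matrix. -/
noncomputable def specNorm (A : Matrix (Fin r) (Fin r) ℝ) : ℝ :=
  ‖Matrix.toEuclideanCLM (𝕜 := ℝ) A‖

/-- `S = U diag(d) U'` with `U` orthogonal and `d` decreasing. -/
structure IsEigenDecomp (S U : Matrix (Fin r) (Fin r) ℝ) (d : Fin r → ℝ) : Prop where
  orthogonal : U ∈ Matrix.orthogonalGroup (Fin r) ℝ
  antitone : Antitone d
  eq : S = U * Matrix.diagonal d * U.transpose

/-- The four Penrose equations: `B` is the Moore-Penrose inverse of the real matrix `A`. -/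
structure IsMoorePenrose (A B : Matrix (Fin r) (Fin r) ℝ) : Prop where
  aba : A * B * A = A
  bab : B * A * B = B
  ab_symm : (A * B).transpose = A * B
  ba_symm : (B * A).transpose = B * A

theorem IsMoorePenrose.unique {A B C : Matrix (Fin r) (Fin r) ℝ}
    (hB : IsMoorePenrose A B) (hC : IsMoorePenrose A C) : B = C := by
  have h1 : A * B = A * C := by
    calc A * B = (A * C * A) * B := by rw [hC.aba]
      _ = (A * C).transpose * (A * B).transpose := by
          rw [hC.ab_symm, hB.ab_symm, Matrix.mul_assoc (A * C) A B]
      _ = (A * B * A * C).transpose := by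
          rw [← Matrix.transpose_mul, ← Matrix.mul_assoc]
      _ = A * C := by rw [hB.aba, hC.ab_symm]
  have h2 : B * A = C * A := by
    calc B * A = B * (A * C * A) := by rw [hC.aba]
      _ = (B * A).transpose * (C * A).transpose := by
          rw [hB.ba_symm, hC.ba_symm]; simp only [Matrix.mul_assoc]
      _ = (C * (A * B * A)).transpose := by
          rw [← Matrix.transpose_mul]; simp only [Matrix.mul_assoc]
      _ = C * A := by rw [hB.aba, hC.ba_symm]
  calc B = B * A * B := hB.bab.symm
    _ = C * A * B := by rw [h2]
    _ = C * (A * C) := by rw [Matrix.mul_assoc, h1]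
    _ = C := by rw [← Matrix.mul_assoc, hC.bab]

theorem isMoorePenrose_diagonal (d : Fin r → ℝ) :
    IsMoorePenrose (Matrix.diagonal d) (Matrix.diagonal fun i => (d i)⁻¹) := by
  constructor <;> simp only [Matrix.diagonal_mul_diagonal, Matrix.diagonal_transpose]
  · congr 1; funext i; exact mul_inv_mul_cancel (d i)
  · congr 1; funext i
    by_cases h : d i = 0
    · simp [h]
    · field_simp

open Classical in
/-- The Moore-Penrose inverse of a matrix. -/
noncomputable def pinv (A : Matrix (Fin r) (Fin r) ℝ) : Matrix (Fin r) (Fin r) ℝ :=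
  if h : ∃ B, IsMoorePenrose A B then h.choose else 0

theorem pinv_diagonal (d : Fin r → ℝ) :
    pinv (Matrix.diagonal d) = Matrix.diagonal fun i => (d i)⁻¹ := by
  have h : ∃ B, IsMoorePenrose (Matrix.diagonal d) B := ⟨_, isMoorePenrose_diagonal d⟩
  unfold pinv
  rw [dif_pos h]
  exact h.choose_spec.unique (isMoorePenrose_diagonal d)

/-- The square root `diag(d)^{1/2}` of a diagonal matrix with nonnegative entries. -/
noncomputable def sqrtDiag (d : Fin r → ℝ) : Matrix (Fin r) (Fin r) ℝ :=
  Matrix.diagonal fun i => Real.sqrt (d i)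

/-- The corrected estimator
`U diag(d)^{1/2} (diag(dπ)^{1/2})^+ diag(s) Uπ' θπ`. -/
noncomputable def corrected (U : Matrix (Fin r) (Fin r) ℝ) (d : Fin r → ℝ)
    (Uπ : Matrix (Fin r) (Fin r) ℝ) (dπ : Fin r → ℝ) (s : Fin r → ℝ)
    (θπ : EuclideanSpace ℝ (Fin r)) : EuclideanSpace ℝ (Fin r) :=
  Matrix.toEuclideanCLM (𝕜 := ℝ)
    (U * sqrtDiag d * pinv (sqrtDiag dπ) * Matrix.diagonal s * Uπ.transpose) θπ

end Matrices

/-- `R₁, …, R_r` are i.i.d. Rademacher random variables under `Q`. -/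
structure IsIIDRademacher {Ω : Type*} [MeasurableSpace Ω] {r : ℕ} (Q : Measure Ω)
    (R : Fin r → Ω → ℝ) : Prop where
  measurable : ∀ i, Measurable (R i)
  prob_one : ∀ i, Q {ω | R i ω = 1} = 1 / 2
  prob_neg_one : ∀ i, Q {ω | R i ω = -1} = 1 / 2
  indep : iIndepFun R Q

end PermCorr

open PermCorr

/-! Write Y = √n θ̂π, and let d and dπ be the ordered eigenvalues of Σ and Σπ. The scaled corrected
estimator is Û diag(ρ̂ₖ Rₖ) Ûπ' Y, where ρ̂ₖ = √d̂ₖ / √d̂πₖ is read as 0 when the denominator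
vanishes. With the limits ρ = √d / √dπ and Uπ in place of ρ̂ and Ûπ, the map Û diag(ρ s) Uπ' sends
N(0, Σπ) to N(0, Û diag(d) Û') for every sign vector s. That law is close to N(0, Σ), because Û is
close to some eigenvector matrix of Σ. Convergence of Û itself is not needed, so Σ may have repeated
eigenvalues.

Two things obstruct the replacement. Beyond the rank of Σπ the ratio ρ̂ₖ would be of the form 0/0;
the rank assumptions force both ρ̂ₖ and ρₖ to be exactly 0 there. Within the rank the eigenvalues of
Σπ are simple, so the columns of Ûπ approach those of Uπ only up to signs e(M), which may depend on
the permutation and hence on Y. The Rademacher factors remove this dependence: given the data,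
R·e(M) has the law of R and is independent of M. The deterministic estimate is
`exists_perturbation_bound`; the sign argument is `integral_signed_eq`, which with
`map_multivariateGaussian` gives `blDist_signed_le`.

The majorant clause is handled separately. By `condWeakConv_iff` it says that h(Yₙ) is approximable
by measurable maps in outer probability. This property survives small perturbations and, under
tightness, continuous maps (`NearMeasurable.comp_continuous`), so it passes from Û, Ûπ, R and Y to
the corrected estimator. -/

namespace PermCorr

/-! ### Outer probability and approximation by measurable maps -/

section OuterProbability

variable {Ω : Type*} [MeasurableSpace Ω]

/-- The maps `T n` are eventually below every `ε > 0`, up to outer probability `ε`. -/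
def SmallInProb (P : Measure Ω) (T : ℕ → Ω → ℝ) : Prop :=
  ∀ ε > 0, ∀ᶠ n in atTop, P {ω | ε ≤ T n ω} ≤ ENNReal.ofReal ε

/-- One ε can serve both as threshold and as probability bound: applying the bound to the minimum of
the two tolerances recovers the usual pair of quantifiers. -/
theorem tendstoInMeasure_zero_iff {P : Measure Ω} {T : ℕ → Ω → ℝ} :
    TendstoInMeasure P T atTop (fun _ => (0 : ℝ)) ↔ SmallInProb P (fun n ω => |T n ω|) := by
  rw [tendstoInMeasure_iff_norm]
  simp only [sub_zero, Real.norm_eq_abs]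
  constructor
  · intro h ε hε
    exact ((ENNReal.tendsto_nhds_zero.1 (h ε hε)) _ (ENNReal.ofReal_pos.2 hε))
  · intro h ε hε
    rw [ENNReal.tendsto_nhds_zero]
    intro δ hδ
    obtain ⟨δ', hδ', hle⟩ : ∃ δ' : ℝ, 0 < δ' ∧ ENNReal.ofReal δ' ≤ δ := by
      rcases eq_or_ne δ ∞ with rfl | hne
      · exact ⟨1, one_pos, le_top⟩
      · exact ⟨δ.toReal, ENNReal.toReal_pos hδ.ne' hne, ENNReal.ofReal_toReal_le⟩
    filter_upwards [h (min ε δ') (lt_min hε hδ')] with n hn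
    refine (measure_mono ?_).trans
      (hn.trans ((ENNReal.ofReal_le_ofReal (min_le_right _ _)).trans hle))
    intro ω hω
    change min ε δ' ≤ |T n ω|
    exact (min_le_left ε δ').trans hω

theorem SmallInProb.mono {P : Measure Ω} {T T' : ℕ → Ω → ℝ} (h : SmallInProb P T)
    (hT : ∀ n ω, T' n ω ≤ T n ω) : SmallInProb P T' := by
  intro ε hε
  filter_upwards [h ε hε] with n hn
  exact (measure_mono fun ω hω => le_trans (by exact hω) (hT n ω)).trans hn

/-- The maps `Y n` are approximated by measurable maps in outer probability. -/
def NearMeasurable {E : Type*} [PseudoMetricSpace E] [MeasurableSpace E] (P : Measure Ω)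
    (Y : ℕ → Ω → E) : Prop :=
  ∀ ε > 0, ∃ V : ℕ → Ω → E, (∀ n, Measurable (V n)) ∧
    ∀ᶠ n in atTop, P {ω | ε ≤ dist (Y n ω) (V n ω)} ≤ ENNReal.ofReal ε

theorem NearMeasurable.of_measurable {E : Type*} [PseudoMetricSpace E] [MeasurableSpace E]
    {P : Measure Ω} {Y : ℕ → Ω → E} (hY : ∀ n, Measurable (Y n)) : NearMeasurable P Y := by
  refine fun ε hε => ⟨Y, hY, Eventually.of_forall fun n => ?_⟩
  simp [not_le.2 hε]

theorem NearMeasurable.of_close {E : Type*} [PseudoMetricSpace E] [MeasurableSpace E]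
    {P : Measure Ω} {Y Y' : ℕ → Ω → E} (hY : NearMeasurable P Y)
    (h : SmallInProb P (fun n ω => dist (Y' n ω) (Y n ω))) : NearMeasurable P Y' := by
  intro ε hε
  obtain ⟨V, hV, hVY⟩ := hY (ε / 2) (by positivity)
  refine ⟨V, hV, ?_⟩
  filter_upwards [hVY, h (ε / 2) (by positivity)] with n h1 h2
  calc P {ω | ε ≤ dist (Y' n ω) (V n ω)}
      ≤ P ({ω | ε / 2 ≤ dist (Y' n ω) (Y n ω)} ∪ {ω | ε / 2 ≤ dist (Y n ω) (V n ω)}) := by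
        refine measure_mono fun ω hω => ?_
        by_contra hc
        simp only [Set.mem_union, Set.mem_ofPred_eq, not_or, not_le] at hc hω
        linarith [dist_triangle (Y' n ω) (Y n ω) (V n ω)]
    _ ≤ ENNReal.ofReal (ε / 2) + ENNReal.ofReal (ε / 2) :=
        (measure_union_le _ _).trans (add_le_add h2 h1)
    _ = ENNReal.ofReal ε := by
        rw [← ENNReal.ofReal_add (by positivity) (by positivity), add_halves]

/-- A continuous map is uniformly continuous at the points of a compact set even when only one of
the two points compared lies in the set. Hence tightness is required of `Y` alone, and not of its
measurable approximants. -/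
theorem NearMeasurable.comp_continuous {E F : Type*} [PseudoMetricSpace E] [MeasurableSpace E]
    [BorelSpace E] [PseudoMetricSpace F] [MeasurableSpace F] [BorelSpace F]
    {P : Measure Ω} {Y : ℕ → Ω → E} (hY : NearMeasurable P Y) {f : E → F} (hf : Continuous f)
    (htight : ∀ ε > 0, ∃ K : Set E, IsCompact K ∧
      ∀ᶠ n in atTop, P {ω | Y n ω ∉ K} ≤ ENNReal.ofReal ε) :
    NearMeasurable P (fun n ω => f (Y n ω)) := by
  intro ε hε
  obtain ⟨K, hK, hKY⟩ := htight (ε / 2) (by positivity)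
  have huc := hK.uniformContinuousAt_of_continuousAt f (fun a _ => hf.continuousAt)
    (Metric.dist_mem_uniformity hε)
  obtain ⟨δ, hδ, hδf⟩ := Metric.mem_uniformity_dist.1 huc
  obtain ⟨V, hV, hVY⟩ := hY (min δ (ε / 2)) (by positivity)
  refine ⟨fun n ω => f (V n ω), fun n => hf.measurable.comp (hV n), ?_⟩
  filter_upwards [hVY, hKY] with n h1 h2
  calc P {ω | ε ≤ dist (f (Y n ω)) (f (V n ω))}
      ≤ P ({ω | Y n ω ∉ K} ∪ {ω | min δ (ε / 2) ≤ dist (Y n ω) (V n ω)}) := by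
        refine measure_mono fun ω hω => ?_
        by_contra hc
        simp only [Set.mem_union, Set.mem_ofPred_eq, not_or, not_not, not_le] at hc hω
        have := hδf (lt_of_lt_of_le hc.2 (min_le_left _ _)) hc.1
        exact absurd this (not_lt.2 hω)
    _ ≤ ENNReal.ofReal (ε / 2) + ENNReal.ofReal (ε / 2) :=
        (measure_union_le _ _).trans
          (add_le_add h2 (h1.trans (ENNReal.ofReal_le_ofReal (min_le_right _ _))))
    _ = ENNReal.ofReal ε := by
        rw [← ENNReal.ofReal_add (by positivity) (by positivity), add_halves]

theorem NearMeasurable.pi {ι : Type*} [Fintype ι] {P : Measure Ω} {Y : ℕ → Ω → ι → ℝ}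
    (hY : ∀ i, NearMeasurable P (fun n ω => Y n ω i)) : NearMeasurable P Y := by
  intro ε hε
  -- The extra 1 keeps `c ≥ 1` when `ι` is empty.
  set c : ℝ := Fintype.card ι + 1 with hc
  have hc1 : 1 ≤ c := by simp [hc]
  have hc0 : 0 < c := by linarith
  have hεc : 0 < ε / c := by positivity
  choose V hV hVY using fun i => hY i (ε / c) hεc
  refine ⟨fun n ω i => V i n ω, fun n => measurable_pi_lambda _ fun i => hV i n, ?_⟩
  filter_upwards [eventually_all.2 hVY] with n hn
  calc P {ω | ε ≤ dist (Y n ω) (fun i => V i n ω)}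
      ≤ P (⋃ i, {ω | ε / c ≤ dist (Y n ω i) (V i n ω)}) := by
        refine measure_mono fun ω hω => ?_
        by_contra hcon
        simp only [Set.mem_iUnion, Set.mem_ofPred_eq, not_exists, not_le] at hcon hω
        have h1 := (dist_pi_lt_iff hεc).2 hcon
        have h2 : ε / c ≤ ε := div_le_self hε.le hc1
        linarith
    _ ≤ ∑ i : ι, ENNReal.ofReal (ε / c) :=
        (measure_iUnion_fintype_le _ _).trans (Finset.sum_le_sum fun i _ => hn i)
    _ = ENNReal.ofReal (Fintype.card ι * (ε / c)) := by
        rw [Finset.sum_const, Finset.card_univ, nsmul_eq_mul, ENNReal.ofReal_mul (by positivity),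
          ENNReal.ofReal_natCast]
    _ ≤ ENNReal.ofReal ε := by
        refine ENNReal.ofReal_le_ofReal ?_
        rw [mul_div_assoc', div_le_iff₀ hc0]
        nlinarith

/-- Take measurable `U ≥ T` and `U' ≥ -T` with nearly optimal integrals. Then `0 ≤ U - T ≤ U + U'`,
and `U + U'` has small integral, so Markov's inequality makes `U` the approximant. -/
theorem nearMeasurable_of_outerExp {P : Measure Ω} [IsProbabilityMeasure P] {T : ℕ → Ω → ℝ} {C : ℝ}
    (hT : ∀ n ω, |T n ω| ≤ C)
    (h : Tendsto (fun n => outerExp P (T n) - innerExp P (T n)) atTop (𝓝 0)) :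
    NearMeasurable P T := by
  have key : ∀ (S : Ω → ℝ), (∀ ω, |S ω| ≤ C) → ∀ δ > 0, ∃ U : Ω → ℝ, Measurable U ∧
      Integrable U P ∧ (∀ ω, S ω ≤ U ω) ∧ ∫ ω, U ω ∂P < outerExp P S + δ := by
    intro S hS δ hδ
    obtain ⟨x, ⟨U, hU, hUi, hle, rfl⟩, hx⟩ := exists_lt_of_csInf_lt
      (s := {x | ∃ U : Ω → ℝ, Measurable U ∧ Integrable U P ∧ (∀ ω, S ω ≤ U ω) ∧ x = ∫ ω, U ω ∂P})
      ⟨_, fun _ => C, measurable_const, integrable_const _, fun ω => (abs_le.1 (hS ω)).2, rfl⟩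
      (lt_add_of_pos_right (outerExp P S) hδ)
    exact ⟨U, hU, hUi, hle, hx⟩
  intro ε hε
  -- Two slacks of ε²/4 and a gap of ε²/2 add up to ε², which Markov's inequality at level ε turns
  -- into probability ε.
  choose U hU hUi hle hlt using fun n => key (T n) (hT n) (ε ^ 2 / 4) (by positivity)
  choose U' hU' hUi' hle' hlt' using fun n => key (fun ω => -T n ω)
    (fun ω => by rw [abs_neg]; exact hT n ω) (ε ^ 2 / 4) (by positivity)
  refine ⟨U, hU, ?_⟩
  filter_upwards [h.eventually_lt_const (show (0 : ℝ) < ε ^ 2 / 2 by positivity)] with n hn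
  have h1 : ∫ ω, (U n ω + U' n ω) ∂P ≤ ε ^ 2 := by
    rw [integral_add (hUi n) (hUi' n)]
    have := hlt n
    have := hlt' n
    unfold innerExp at hn
    linarith
  have h2 := mul_meas_ge_le_integral_of_nonneg (μ := P) (f := fun ω => U n ω + U' n ω)
    (ae_of_all _ fun ω => by have := hle n ω; have := hle' n ω; simp only [Pi.zero_apply]; linarith)
    ((hUi n).add (hUi' n)) ε
  have h3 : P.real {ω | ε ≤ U n ω + U' n ω} ≤ ε := by
    have : ε * P.real {ω | ε ≤ U n ω + U' n ω} ≤ ε * ε := by nlinarith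
    exact le_of_mul_le_mul_left this hε
  calc P {ω | ε ≤ dist (T n ω) (U n ω)} ≤ P {ω | ε ≤ U n ω + U' n ω} := by
        refine measure_mono fun ω hω => ?_
        simp only [Set.mem_ofPred_eq, Real.dist_eq] at hω ⊢
        have := hle n ω
        have := hle' n ω
        rw [abs_of_nonpos (by linarith)] at hω
        linarith
    _ = ENNReal.ofReal (P.real {ω | ε ≤ U n ω + U' n ω}) := by simp
    _ ≤ ENNReal.ofReal ε := ENNReal.ofReal_le_ofReal h3

end OuterProbability

/-! ### Joint and conditional smallness on the product space -/

section Product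

set_option linter.unusedSectionVars false
variable {Ω₁ Ω₂ : Type*} [MeasurableSpace Ω₁] [MeasurableSpace Ω₂]
  {Q₁ : Measure Ω₁} {Q₂ : Measure Ω₂} [IsProbabilityMeasure Q₁] [IsProbabilityMeasure Q₂]

theorem NearMeasurable.comp_fst {E : Type*} [PseudoMetricSpace E] [MeasurableSpace E]
    {Y : ℕ → Ω₁ → E} (hY : NearMeasurable Q₁ Y) :
    NearMeasurable (Q₁.prod Q₂) (fun n p => Y n p.1) := by
  intro ε hε
  obtain ⟨V, hV, hVY⟩ := hY ε hε
  refine ⟨fun n p => V n p.1, fun n => (hV n).comp measurable_fst, ?_⟩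
  filter_upwards [hVY] with n hn
  have : {p : Ω₁ × Ω₂ | ε ≤ dist (Y n p.1) (V n p.1)} =
      {ω | ε ≤ dist (Y n ω) (V n ω)} ×ˢ Set.univ := by ext; simp
  rw [this, Measure.prod_prod, measure_univ, mul_one]
  exact hn

theorem SmallInProb.comp_fst {T : ℕ → Ω₁ → ℝ} (hT : SmallInProb Q₁ T) :
    SmallInProb (Q₁.prod Q₂) (fun n p => T n p.1) := by
  intro ε hε
  filter_upwards [hT ε hε] with n hn
  have : {p : Ω₁ × Ω₂ | ε ≤ T n p.1} = {ω | ε ≤ T n ω} ×ˢ Set.univ := by ext; simp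
  rw [this, Measure.prod_prod, measure_univ, mul_one]
  exact hn

/-- By Fubini the section masses integrate to the joint mass, so this is Markov's inequality in the
data variable. -/
theorem measure_section_ge_le {B : Set (Ω₁ × Ω₂)} (hB : MeasurableSet B) {a b : ℝ} (ha : 0 < a)
    (h : (Q₁.prod Q₂) B ≤ ENNReal.ofReal (a * b)) :
    Q₁ {ω₁ | a ≤ Q₂.real (Prod.mk ω₁ ⁻¹' B)} ≤ ENNReal.ofReal b := by
  have h1 := meas_ge_le_lintegral_div (μ := Q₁) (f := fun ω₁ => Q₂ (Prod.mk ω₁ ⁻¹' B))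
    (measurable_measure_prodMk_left hB).aemeasurable (ε := ENNReal.ofReal a)
    (by simpa using ha) ENNReal.ofReal_ne_top
  rw [← Measure.prod_apply hB] at h1
  have h2 : {ω₁ | a ≤ Q₂.real (Prod.mk ω₁ ⁻¹' B)} =
      {ω₁ | ENNReal.ofReal a ≤ Q₂ (Prod.mk ω₁ ⁻¹' B)} := by
    ext ω
    simp only [Set.mem_ofPred_eq]
    rw [ENNReal.ofReal_le_iff_le_toReal (measure_ne_top _ _)]; rfl
  rw [h2]
  refine h1.trans (ENNReal.div_le_of_le_mul ?_)
  rwa [mul_comm, ← ENNReal.ofReal_mul ha.le]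

/-- Sections of mass below `a` contribute at most `a` in total; the remaining ones have mass at most
1 and occupy a set of measure at most `b`. -/
theorem measure_prod_le_of_section {B : Set (Ω₁ × Ω₂)} (hB : MeasurableSet B) {a b : ℝ}
    (ha : 0 ≤ a) (hb : 0 ≤ b)
    (h : Q₁ {ω₁ | a ≤ Q₂.real (Prod.mk ω₁ ⁻¹' B)} ≤ ENNReal.ofReal b) :
    (Q₁.prod Q₂) B ≤ ENNReal.ofReal (a + b) := by
  rw [Measure.prod_apply hB]
  have hm : MeasurableSet {ω₁ | a ≤ Q₂.real (Prod.mk ω₁ ⁻¹' B)} :=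
    measurableSet_le measurable_const (measurable_measure_prodMk_left hB).ennreal_toReal
  calc ∫⁻ ω₁, Q₂ (Prod.mk ω₁ ⁻¹' B) ∂Q₁
      ≤ ∫⁻ ω₁, (ENNReal.ofReal a +
          {ω₁ | a ≤ Q₂.real (Prod.mk ω₁ ⁻¹' B)}.indicator 1 ω₁) ∂Q₁ := by
        refine lintegral_mono fun ω₁ => ?_
        by_cases hω : a ≤ Q₂.real (Prod.mk ω₁ ⁻¹' B)
        · simp only [Set.indicator, Set.mem_ofPred_eq, hω, if_true, Pi.one_apply]
          exact prob_le_one.trans le_add_self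
        · simp only [Set.indicator, Set.mem_ofPred_eq, hω, if_false, add_zero]
          rw [← ENNReal.ofReal_toReal (measure_ne_top Q₂ (Prod.mk ω₁ ⁻¹' B))]
          exact ENNReal.ofReal_le_ofReal (le_of_not_ge hω)
    _ ≤ ENNReal.ofReal a + ENNReal.ofReal b := by
        rw [lintegral_add_left measurable_const, lintegral_indicator_one hm, lintegral_const,
          measure_univ, mul_one]
        gcongr
    _ = ENNReal.ofReal (a + b) := (ENNReal.ofReal_add ha hb).symm

/-- The majorant is itself the approximant: its distance to `T` is at most the gap between majorant
and minorant, whose conditional mean is small. -/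
theorem nearMeasurable_of_majorant {T : ℕ → Ω₁ × Ω₂ → ℝ} (hT : ∀ n p, |T n p| ≤ 1)
    (h : TendstoInMeasure Q₁ (fun n ω₁ =>
      ∫ ω₂, majorant (Q₁.prod Q₂) (T n) (ω₁, ω₂) ∂Q₂ -
      ∫ ω₂, minorant (Q₁.prod Q₂) (T n) (ω₁, ω₂) ∂Q₂) atTop (fun _ => (0 : ℝ))) :
    NearMeasurable (Q₁.prod Q₂) T := by
  rw [tendstoInMeasure_zero_iff] at h
  intro ε hε
  have hU := fun n => majorant_spec (Q₁.prod Q₂) (T n) 1 (hT n)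
  have hL := fun n => majorant_spec (Q₁.prod Q₂) (fun p => -T n p) 1
    (fun p => by rw [abs_neg]; exact hT n p)
  refine ⟨fun n => majorant (Q₁.prod Q₂) (T n), fun n => (hU n).measurable, ?_⟩
  have hδ : 0 < min (ε / 2) (ε ^ 2 / 2) := by positivity
  filter_upwards [h _ hδ] with n hn
  set U := majorant (Q₁.prod Q₂) (T n) with hUdef
  set L := majorant (Q₁.prod Q₂) (fun p => -T n p) with hLdef
  have hUb : ∀ᵐ p ∂(Q₁.prod Q₂), |U p| ≤ 1 := by
    filter_upwards [(hU n).ae_le (fun _ => 1) measurable_const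
      (ae_of_all _ fun p => (abs_le.1 (hT n p)).2)] with p hp
    exact abs_le.2 ⟨by linarith [(abs_le.1 (hT n p)).1, (hU n).le p], hp⟩
  have hLb : ∀ᵐ p ∂(Q₁.prod Q₂), |L p| ≤ 1 := by
    filter_upwards [(hL n).ae_le (fun _ => 1) measurable_const
      (ae_of_all _ fun p => by linarith [(abs_le.1 (hT n p)).1])] with p hp
    exact abs_le.2 ⟨by linarith [(abs_le.1 (hT n p)).2, (hL n).le p], hp⟩
  set B : Set (Ω₁ × Ω₂) := {p | ε ≤ U p + L p} with hBdef
  have hB : MeasurableSet B :=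
    measurableSet_le measurable_const ((hU n).measurable.add (hL n).measurable)
  have hsub : {p | ε ≤ dist (T n p) (U p)} ⊆ B := by
    intro p hp
    simp only [hBdef, Set.mem_ofPred_eq, Real.dist_eq] at hp ⊢
    have := (hU n).le p
    have := (hL n).le p
    rw [abs_of_nonpos (by linarith)] at hp
    linarith
  refine (measure_mono hsub).trans ?_
  rw [show ε = ε / 2 + ε / 2 by ring]
  refine measure_prod_le_of_section hB (by positivity) (by positivity) ?_
  refine le_trans (measure_mono_ae ?_) (hn.trans (ENNReal.ofReal_le_ofReal (min_le_left _ _)))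
  -- The majorants are bounded only almost everywhere, so their sections are known to be integrable
  -- only for almost every `ω₁`.
  filter_upwards [Measure.ae_ae_of_ae_prod hUb, Measure.ae_ae_of_ae_prod hLb] with ω₁ h1 h2
  intro hω
  have hω' : ε / 2 ≤ Q₂.real (Prod.mk ω₁ ⁻¹' B) := hω
  have hUi : Integrable (fun ω₂ => U (ω₁, ω₂)) Q₂ :=
    Integrable.of_bound ((hU n).measurable.comp measurable_prodMk_left).aestronglyMeasurable 1 h1
  have hLi : Integrable (fun ω₂ => L (ω₁, ω₂)) Q₂ :=
    Integrable.of_bound ((hL n).measurable.comp measurable_prodMk_left).aestronglyMeasurable 1 h2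
  have hmk := mul_meas_ge_le_integral_of_nonneg (μ := Q₂) (f := fun ω₂ => U (ω₁, ω₂) + L (ω₁, ω₂))
    (ae_of_all _ fun ω₂ => by
      have := (hU n).le (ω₁, ω₂); have := (hL n).le (ω₁, ω₂)
      simp only [Pi.zero_apply]; linarith) (hUi.add hLi) ε
  rw [integral_add hUi hLi] at hmk
  change min (ε / 2) (ε ^ 2 / 2) ≤ |∫ ω₂, U (ω₁, ω₂) ∂Q₂ - ∫ ω₂, -L (ω₁, ω₂) ∂Q₂|
  rw [integral_neg, sub_neg_eq_add]
  refine (min_le_right _ _).trans (le_trans ?_ (le_abs_self _))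
  refine le_trans ?_ hmk
  calc ε ^ 2 / 2 = ε * (ε / 2) := by ring
    _ ≤ ε * Q₂.real (Prod.mk ω₁ ⁻¹' B) := by gcongr
    _ = _ := rfl

/-- An approximant `V` yields explicit measurable majorants of `T` and `-T`: `±V + e` off a
measurable hull `B` of the exceptional set, and 1 on `B`. Minimality bounds the gap by `2e + 2·1_B`.
-/
theorem NearMeasurable.tendstoInMeasure_majorant {T : ℕ → Ω₁ × Ω₂ → ℝ} (hT : ∀ n p, |T n p| ≤ 1)
    (h : NearMeasurable (Q₁.prod Q₂) T) :
    TendstoInMeasure Q₁ (fun n ω₁ =>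
      ∫ ω₂, majorant (Q₁.prod Q₂) (T n) (ω₁, ω₂) ∂Q₂ -
      ∫ ω₂, minorant (Q₁.prod Q₂) (T n) (ω₁, ω₂) ∂Q₂) atTop (fun _ => (0 : ℝ)) := by
  classical
  rw [tendstoInMeasure_zero_iff]
  intro ε hε
  have hU := fun n => majorant_spec (Q₁.prod Q₂) (T n) 1 (hT n)
  have hL := fun n => majorant_spec (Q₁.prod Q₂) (fun p => -T n p) 1
    (fun p => by rw [abs_neg]; exact hT n p)
  -- Where the section of `B` has mass below ε/4, the gap integrates to less than ε/4 + ε/2. The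
  -- product ε/4 · ε is what `measure_section_ge_le` needs to give the other sections probability at
  -- most ε.
  set e := min (ε / 8) (ε / 4 * ε) with he
  have he0 : 0 < e := by positivity
  obtain ⟨V, hV, hVT⟩ := h e he0
  filter_upwards [hVT] with n hn
  set U := majorant (Q₁.prod Q₂) (T n) with hUdef
  set L := majorant (Q₁.prod Q₂) (fun p => -T n p) with hLdef
  set B := toMeasurable (Q₁.prod Q₂) {p | e ≤ dist (T n p) (V n p)} with hBdef
  have hB : MeasurableSet B := measurableSet_toMeasurable _ _
  have hBP : (Q₁.prod Q₂) B ≤ ENNReal.ofReal (ε / 4 * ε) := by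
    rw [hBdef, measure_toMeasurable]
    exact hn.trans (ENNReal.ofReal_le_ofReal (min_le_right _ _))
  have hnear : ∀ p, p ∉ B → |T n p - V n p| < e := fun p hp => by
    by_contra hc
    exact hp (subset_toMeasurable _ _ (by simpa [Real.dist_eq] using hc))
  have hUb : ∀ᵐ p ∂(Q₁.prod Q₂), |U p| ≤ 1 := by
    filter_upwards [(hU n).ae_le (fun _ => 1) measurable_const
      (ae_of_all _ fun p => (abs_le.1 (hT n p)).2)] with p hp
    exact abs_le.2 ⟨by linarith [(abs_le.1 (hT n p)).1, (hU n).le p], hp⟩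
  have hLb : ∀ᵐ p ∂(Q₁.prod Q₂), |L p| ≤ 1 := by
    filter_upwards [(hL n).ae_le (fun _ => 1) measurable_const
      (ae_of_all _ fun p => by linarith [(abs_le.1 (hT n p)).1])] with p hp
    exact abs_le.2 ⟨by linarith [(abs_le.1 (hT n p)).2, (hL n).le p], hp⟩
  have hUV := (hU n).ae_le (fun p => if p ∈ B then 1 else V n p + e)
    (Measurable.ite hB measurable_const ((hV n).add_const e)) (ae_of_all _ fun p => by
      by_cases hp : p ∈ B
      · simpa [hp] using (abs_le.1 (hT n p)).2
      · have := (abs_lt.1 (hnear p hp)).2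
        simp only [hp, if_false]; linarith)
  have hLV := (hL n).ae_le (fun p => if p ∈ B then 1 else -V n p + e)
    (Measurable.ite hB measurable_const ((hV n).neg.add_const e)) (ae_of_all _ fun p => by
      by_cases hp : p ∈ B
      · simp only [hp, if_true]; linarith [(abs_le.1 (hT n p)).1]
      · have := (abs_lt.1 (hnear p hp)).1
        simp only [hp, if_false]; linarith)
  have hUL : ∀ᵐ p ∂(Q₁.prod Q₂), U p + L p ≤ 2 * e + 2 * B.indicator 1 p := by
    filter_upwards [hUV, hLV] with p h1 h2
    by_cases hp : p ∈ B
    · simp only [hp, if_true, Set.indicator, Pi.one_apply] at h1 h2 ⊢; linarith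
    · simp only [hp, if_false, Set.indicator] at h1 h2 ⊢; linarith
  refine le_trans (measure_mono_ae ?_) (measure_section_ge_le hB (by positivity) hBP)
  filter_upwards [Measure.ae_ae_of_ae_prod hUb, Measure.ae_ae_of_ae_prod hLb,
    Measure.ae_ae_of_ae_prod hUL] with ω₁ h1 h2 h3
  intro hω
  change ε ≤ |∫ ω₂, U (ω₁, ω₂) ∂Q₂ - ∫ ω₂, -L (ω₁, ω₂) ∂Q₂| at hω
  change ε / 4 ≤ Q₂.real (Prod.mk ω₁ ⁻¹' B)
  have hUi : Integrable (fun ω₂ => U (ω₁, ω₂)) Q₂ :=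
    Integrable.of_bound ((hU n).measurable.comp measurable_prodMk_left).aestronglyMeasurable 1 h1
  have hLi : Integrable (fun ω₂ => L (ω₁, ω₂)) Q₂ :=
    Integrable.of_bound ((hL n).measurable.comp measurable_prodMk_left).aestronglyMeasurable 1 h2
  have hsec : MeasurableSet (Prod.mk ω₁ ⁻¹' B) := measurable_prodMk_left hB
  have hind : Integrable ((Prod.mk ω₁ ⁻¹' B).indicator (1 : Ω₂ → ℝ)) Q₂ :=
    (integrable_const (1 : ℝ)).indicator hsec
  rw [integral_neg, sub_neg_eq_add, ← integral_add hUi hLi, abs_of_nonneg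
    (integral_nonneg fun ω₂ => by
      have := (hU n).le (ω₁, ω₂); have := (hL n).le (ω₁, ω₂)
      simp only [Pi.zero_apply]; linarith)] at hω
  have h4 : ∫ ω₂, (U (ω₁, ω₂) + L (ω₁, ω₂)) ∂Q₂ ≤
      ∫ ω₂, (2 * e + 2 * (Prod.mk ω₁ ⁻¹' B).indicator 1 ω₂) ∂Q₂ :=
    integral_mono_ae (hUi.add hLi) ((integrable_const _).add (hind.const_mul 2)) h3
  rw [integral_add (integrable_const _) (hind.const_mul 2), integral_const,
    integral_const_mul, integral_indicator_one hsec] at h4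
  simp only [probReal_univ, smul_eq_mul, one_mul] at h4
  have : e ≤ ε / 8 := min_le_left _ _
  linarith

end Product

/-! ### The bounded-Lipschitz distance -/

section BoundedLipschitz

theorem continuous_of_mem_BL1 {E : Type*} [PseudoMetricSpace E] {h : E → ℝ} (hh : h ∈ BL1 E) :
    Continuous h :=
  (LipschitzWith.of_dist_le_mul (K := 1) fun x y => by
    simpa [Real.dist_eq] using hh.2 x y).continuous

instance {E : Type*} [PseudoMetricSpace E] : Nonempty (BL1 E) :=
  ⟨⟨0, fun x => by simp, fun x y => by simp⟩⟩

variable {Ω E : Type*} [MeasurableSpace Ω] [PseudoMetricSpace E] [MeasurableSpace E]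

/-- The bounded-Lipschitz distance between the law of `Y` under `Q` and `ν`. -/
noncomputable def blDist (Q : Measure Ω) (Y : Ω → E) (ν : Measure E) : ℝ :=
  ⨆ h : BL1 E, |∫ ω, h.1 (Y ω) ∂Q - ∫ z, h.1 z ∂ν|

theorem abs_integral_le_one_of_bound {α : Type*} [MeasurableSpace α] {Q : Measure α}
    [IsProbabilityMeasure Q] {f : α → ℝ} (hf : ∀ x, |f x| ≤ 1) : |∫ x, f x ∂Q| ≤ 1 := by
  simpa using norm_integral_le_of_norm_le_const (μ := Q) 
    (ae_of_all Q fun x => (Real.norm_eq_abs (f x)).le.trans (hf x))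

variable {Q : Measure Ω} [IsProbabilityMeasure Q] {ν : Measure E} [IsProbabilityMeasure ν]

theorem le_blDist (Y : Ω → E) {h : E → ℝ} (hh : h ∈ BL1 E) :
    |∫ ω, h (Y ω) ∂Q - ∫ z, h z ∂ν| ≤ blDist Q Y ν := by
  -- A real supremum dominates its terms only when the family is bounded above; here 1 + 1 is a
  -- bound.
  refine le_ciSup (f := fun h : BL1 E => |∫ ω, h.1 (Y ω) ∂Q - ∫ z, h.1 z ∂ν|)
    ⟨1 + 1, ?_⟩ ⟨h, hh⟩
  rintro _ ⟨h, rfl⟩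
  exact (abs_sub _ _).trans (add_le_add
    (abs_integral_le_one_of_bound fun ω => h.2.1 _) (abs_integral_le_one_of_bound h.2.1))

theorem blDist_nonneg (Q : Measure Ω) (Y : Ω → E) (ν : Measure E) : 0 ≤ blDist Q Y ν :=
  Real.iSup_nonneg fun _ => abs_nonneg _

theorem blDist_le {Q : Measure Ω} {Y : Ω → E} {ν : Measure E} {c : ℝ}
    (hc : ∀ h ∈ BL1 E, |∫ ω, h (Y ω) ∂Q - ∫ z, h z ∂ν| ≤ c) :
    blDist Q Y ν ≤ c :=
  ciSup_le fun h => hc h.1 h.2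

end BoundedLipschitz

/-! ### Conditional weak convergence: reformulation, stability, tightness -/

section CondWeakConv

set_option linter.unusedSectionVars false
variable {Ω₁ Ω₂ E : Type*} [MeasurableSpace Ω₁] [MeasurableSpace Ω₂]
  {Q₁ : Measure Ω₁} {Q₂ : Measure Ω₂} [IsProbabilityMeasure Q₁] [IsProbabilityMeasure Q₂]

/-- This splits the definition into a statement about conditional laws and one about joint
measurability, which can be proved through different approximations of the same sequence. -/
theorem condWeakConv_iff [PseudoMetricSpace E] [MeasurableSpace E] {Y : ℕ → Ω₁ → Ω₂ → E}
    {ν : Measure E} :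
    CondWeakConv Q₁ Q₂ Y ν ↔ SmallInProb Q₁ (fun n ω₁ => blDist Q₂ (Y n ω₁) ν) ∧
      ∀ h ∈ BL1 E, NearMeasurable (Q₁.prod Q₂) (fun n p => h (Y n p.1 p.2)) := by
  have h1 : TendstoInMeasure Q₁ (fun n ω₁ =>
      ⨆ h : BL1 E, |∫ ω₂, h.1 (Y n ω₁ ω₂) ∂Q₂ - ∫ z, h.1 z ∂ν|) atTop (fun _ => (0 : ℝ)) ↔
      SmallInProb Q₁ (fun n ω₁ => blDist Q₂ (Y n ω₁) ν) := by
    rw [tendstoInMeasure_zero_iff]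
    exact iff_of_eq (congrArg _ (by funext n ω₁; exact abs_of_nonneg (blDist_nonneg _ _ _)))
  unfold CondWeakConv
  rw [h1]
  refine and_congr_right fun _ => forall₂_congr fun h hh => ?_
  exact ⟨fun H => nearMeasurable_of_majorant (fun n p => hh.1 _) H,
    fun H => H.tendstoInMeasure_majorant fun n p => hh.1 _⟩

/-- Joint closeness off a set `B` changes each conditional integral by at most `e + 2 Q₂(section of
B)`, and most sections of `B` are small. Measurability in `ω₂` permits subtracting the integrals. -/
theorem SmallInProb.blDist_of_close [PseudoMetricSpace E] [MeasurableSpace E] [BorelSpace E]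
    {W W' : ℕ → Ω₁ → Ω₂ → E} {ν : Measure E} [IsProbabilityMeasure ν]
    (hW : ∀ n ω₁, Measurable (W n ω₁)) (hW' : ∀ n ω₁, Measurable (W' n ω₁))
    (hclose : SmallInProb (Q₁.prod Q₂) (fun n p => dist (W n p.1 p.2) (W' n p.1 p.2)))
    (h : SmallInProb Q₁ (fun n ω₁ => blDist Q₂ (W' n ω₁) ν)) :
    SmallInProb Q₁ (fun n ω₁ => blDist Q₂ (W n ω₁) ν) := by
  intro ε hε
  set e := min (ε / 8) (ε / 8 * (ε / 2)) with he
  have he0 : 0 < e := by positivity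
  filter_upwards [hclose e he0, h (ε / 2) (by positivity)] with n hn hn'
  set B := toMeasurable (Q₁.prod Q₂) {p | e ≤ dist (W n p.1 p.2) (W' n p.1 p.2)} with hBdef
  have hB : MeasurableSet B := measurableSet_toMeasurable _ _
  have hBP : (Q₁.prod Q₂) B ≤ ENNReal.ofReal (ε / 8 * (ε / 2)) := by
    rw [hBdef, measure_toMeasurable]
    exact hn.trans (ENNReal.ofReal_le_ofReal (min_le_right _ _))
  have hnear : ∀ ω₁ ω₂, (ω₁, ω₂) ∉ B → dist (W n ω₁ ω₂) (W' n ω₁ ω₂) < e := fun ω₁ ω₂ hp => by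
    by_contra hc
    exact hp (subset_toMeasurable _ _ (by simpa using hc))
  have hle : ∀ ω₁, blDist Q₂ (W n ω₁) ν ≤
      blDist Q₂ (W' n ω₁) ν + (e + 2 * Q₂.real (Prod.mk ω₁ ⁻¹' B)) := by
    intro ω₁
    refine blDist_le fun h hh => ?_
    have hsec : MeasurableSet (Prod.mk ω₁ ⁻¹' B) := measurable_prodMk_left hB
    have hind : Integrable ((Prod.mk ω₁ ⁻¹' B).indicator (1 : Ω₂ → ℝ)) Q₂ :=
      (integrable_const (1 : ℝ)).indicator hsec
    have hi : ∀ V : Ω₂ → E, Measurable V → Integrable (fun ω₂ => h (V ω₂)) Q₂ := fun V hV =>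
      Integrable.of_bound ((continuous_of_mem_BL1 hh).measurable.comp hV).aestronglyMeasurable 1
        (ae_of_all _ fun ω₂ => hh.1 _)
    have h1 : |∫ ω₂, h (W n ω₁ ω₂) ∂Q₂ - ∫ ω₂, h (W' n ω₁ ω₂) ∂Q₂| ≤
        e + 2 * Q₂.real (Prod.mk ω₁ ⁻¹' B) := by
      rw [← integral_sub (hi _ (hW n ω₁)) (hi _ (hW' n ω₁))]
      rw [← Real.norm_eq_abs]
      refine (norm_integral_le_of_norm_le (g := fun ω₂ =>
        e + 2 * (Prod.mk ω₁ ⁻¹' B).indicator 1 ω₂) ((integrable_const e).add (hind.const_mul 2))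
        (ae_of_all _ fun ω₂ => ?_)).trans (le_of_eq ?_)
      · rw [Real.norm_eq_abs]
        by_cases hω : (ω₁, ω₂) ∈ B
        · have h2 := abs_le.1 (hh.1 (W n ω₁ ω₂))
          have h3 := abs_le.1 (hh.1 (W' n ω₁ ω₂))
          rw [Set.indicator_of_mem (show ω₂ ∈ Prod.mk ω₁ ⁻¹' B from hω), Pi.one_apply]
          exact abs_le.2 ⟨by linarith, by linarith⟩
        · rw [Set.indicator_of_notMem (show ω₂ ∉ Prod.mk ω₁ ⁻¹' B from hω)]
          linarith [hh.2 (W n ω₁ ω₂) (W' n ω₁ ω₂), hnear ω₁ ω₂ hω]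
      · rw [integral_add (integrable_const e) (hind.const_mul 2), integral_const,
          integral_const_mul, integral_indicator_one hsec]
        simp
    have h2 := abs_sub_le (∫ ω₂, h (W n ω₁ ω₂) ∂Q₂) (∫ ω₂, h (W' n ω₁ ω₂) ∂Q₂) (∫ z, h z ∂ν)
    have h3 := le_blDist (Q := Q₂) (ν := ν) (W' n ω₁) hh
    linarith
  calc Q₁ {ω₁ | ε ≤ blDist Q₂ (W n ω₁) ν}
      ≤ Q₁ ({ω₁ | ε / 2 ≤ blDist Q₂ (W' n ω₁) ν} ∪
          {ω₁ | ε / 8 ≤ Q₂.real (Prod.mk ω₁ ⁻¹' B)}) := by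
        refine measure_mono fun ω₁ hω => ?_
        by_contra hc
        simp only [Set.mem_union, Set.mem_ofPred_eq, not_or, not_le] at hc hω
        have := hle ω₁
        have : e ≤ ε / 8 := min_le_left _ _
        linarith
    _ ≤ ENNReal.ofReal (ε / 2) + ENNReal.ofReal (ε / 2) :=
        (measure_union_le _ _).trans
          (add_le_add hn' (measure_section_ge_le hB (by positivity) hBP))
    _ = ENNReal.ofReal ε := by
        rw [← ENNReal.ofReal_add (by positivity) (by positivity), add_halves]

/-- Bounded-Lipschitz functions that vanish on the ball of radius `K` and equal one off the ball of
radius `K + 1`. -/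
noncomputable def tailFun (E : Type*) [NormedAddCommGroup E] (K : ℝ) (y : E) : ℝ :=
  max 0 (min 1 (‖y‖ - K))

theorem tailFun_mem_BL1 [NormedAddCommGroup E] (K : ℝ) : tailFun E K ∈ BL1 E := by
  refine ⟨fun y => ?_, fun x y => ?_⟩
  · unfold tailFun
    exact abs_le.2 ⟨(by norm_num : (-1 : ℝ) ≤ 0).trans (le_max_left _ _),
      max_le zero_le_one (min_le_left _ _)⟩
  · unfold tailFun
    have h1 := abs_max_sub_max_le_abs (min 1 (‖x‖ - K)) (min 1 (‖y‖ - K)) 0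
    have h2 := abs_min_sub_min_le_max 1 (‖x‖ - K) 1 (‖y‖ - K)
    rw [max_comm 0, max_comm 0]
    refine h1.trans (h2.trans ?_)
    rw [sub_self, abs_zero, sub_sub_sub_cancel_right, dist_eq_norm]
    exact max_le (norm_nonneg _) (abs_norm_sub_norm_le x y)

theorem tendsto_integral_tailFun [NormedAddCommGroup E] [MeasurableSpace E] [BorelSpace E]
    (ν : Measure E) [IsProbabilityMeasure ν] :
    Tendsto (fun K : ℕ => ∫ y, tailFun E K y ∂ν) atTop (𝓝 0) := by
  have := tendsto_integral_of_dominated_convergence (μ := ν)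
    (F := fun (K : ℕ) y => tailFun E K y) (f := fun _ => 0) (fun _ => (1 : ℝ))
    (fun K => (continuous_of_mem_BL1 (tailFun_mem_BL1 (E := E) K)).measurable.aestronglyMeasurable)
    (integrable_const _) (fun K => ae_of_all _ (tailFun_mem_BL1 (E := E) K).1)
    (ae_of_all _ fun y => ?_)
  · simpa using this
  · obtain ⟨N, hN⟩ := exists_nat_ge ‖y‖
    refine tendsto_const_nhds.congr' ?_
    filter_upwards [eventually_ge_atTop N] with K hK
    have : (N : ℝ) ≤ K := by exact_mod_cast hK
    unfold tailFun
    rw [max_eq_left ((min_le_right _ _).trans (by linarith))]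

/-- A tail function has small integral under `ν`, hence small conditional mean along `Y`. Since `Y`
need not be jointly measurable, Markov's inequality and Fubini are applied through a measurable
approximant of the tail function. -/
theorem CondWeakConv.tight [NormedAddCommGroup E] [MeasurableSpace E] [BorelSpace E]
    {Y : ℕ → Ω₁ → Ω₂ → E} {ν : Measure E} [IsProbabilityMeasure ν]
    (hY : ∀ n ω₁, Measurable (Y n ω₁)) (h : CondWeakConv Q₁ Q₂ Y ν) {ε : ℝ} (hε : 0 < ε) :
    ∃ K : ℝ, 1 ≤ K ∧
      ∀ᶠ n in atTop, (Q₁.prod Q₂) {p | K < ‖Y n p.1 p.2‖} ≤ ENNReal.ofReal ε := by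
  rw [condWeakConv_iff] at h
  obtain ⟨K, hK⟩ := ((tendsto_integral_tailFun ν).eventually_lt_const
    (show (0 : ℝ) < ε / 16 by positivity)).exists
  have hh := tailFun_mem_BL1 (E := E) K
  set φ := tailFun E K
  have hφ0 : ∀ y, 0 ≤ φ y := fun y => le_max_left _ _
  obtain ⟨V, hV, hVY⟩ := h.2 φ hh (min (1 / 4) (ε / 4)) (by positivity)
  refine ⟨K + 1, by simp, ?_⟩
  filter_upwards [hVY, h.1 (ε / 16) (by positivity)] with n hn hn'
  set A := {p : Ω₁ × Ω₂ | min (1 / 4) (ε / 4) ≤ dist (φ (Y n p.1 p.2)) (V n p)} with hA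
  set B := toMeasurable (Q₁.prod Q₂) A with hBdef
  have hB : MeasurableSet B := measurableSet_toMeasurable _ _
  -- `G` is measurable and, with `B`, covers the event in question. On it the tail function is at
  -- least 3/4 - 1/4 = 1/2.
  set G := {p | 3 / 4 ≤ V n p} \ B with hG
  have hGm : MeasurableSet G := (measurableSet_le measurable_const (hV n)).diff hB
  have hnear : ∀ p, p ∉ B → |φ (Y n p.1 p.2) - V n p| < 1 / 4 := fun p hp => by
    by_contra hc
    refine hp (subset_toMeasurable _ _ ?_)
    change _ ≤ dist _ _
    rw [Real.dist_eq]
    exact (min_le_left _ _).trans (not_lt.1 hc)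
  have hsub : {p : Ω₁ × Ω₂ | (K : ℝ) + 1 < ‖Y n p.1 p.2‖} ⊆ B ∪ G := by
    intro p hp
    by_cases hpB : p ∈ B
    · exact Or.inl hpB
    · refine Or.inr ⟨?_, hpB⟩
      have hp' : (K : ℝ) + 1 < ‖Y n p.1 p.2‖ := hp
      have h1 : φ (Y n p.1 p.2) = 1 := by
        change max 0 (min 1 (‖Y n p.1 p.2‖ - K)) = 1
        rw [min_eq_left (by linarith), max_eq_right zero_le_one]
      have := abs_lt.1 (hnear p hpB)
      rw [h1] at this
      change 3 / 4 ≤ V n p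
      linarith
  have hGP : (Q₁.prod Q₂) G ≤ ENNReal.ofReal (ε / 2 + ε / 16) := by
    refine measure_prod_le_of_section hGm (by positivity) (by positivity)
      (le_trans (measure_mono fun ω₁ hω => ?_) hn')
    have hω' : ε / 2 ≤ Q₂.real (Prod.mk ω₁ ⁻¹' G) := hω
    change ε / 16 ≤ blDist Q₂ (Y n ω₁) ν
    have hi : Integrable (fun ω₂ => φ (Y n ω₁ ω₂)) Q₂ :=
      Integrable.of_bound
        ((continuous_of_mem_BL1 hh).measurable.comp (hY n ω₁)).aestronglyMeasurable 1
        (ae_of_all _ fun ω₂ => hh.1 _)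
    have hmk := mul_meas_ge_le_integral_of_nonneg (μ := Q₂) (f := fun ω₂ => φ (Y n ω₁ ω₂))
      (ae_of_all _ fun ω₂ => hφ0 _) hi (1 / 2)
    have hmono : Q₂.real (Prod.mk ω₁ ⁻¹' G) ≤ Q₂.real {ω₂ | 1 / 2 ≤ φ (Y n ω₁ ω₂)} := by
      refine measureReal_mono fun ω₂ hω₂ => ?_
      have h1 := abs_lt.1 (hnear (ω₁, ω₂) hω₂.2)
      have h2 : 3 / 4 ≤ V n (ω₁, ω₂) := hω₂.1
      change 1 / 2 ≤ φ (Y n ω₁ ω₂)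
      simp only at h1
      linarith
    have h3 := (abs_le.1 (le_blDist (Q := Q₂) (ν := ν) (Y n ω₁) hh)).2
    linarith
  calc (Q₁.prod Q₂) {p : Ω₁ × Ω₂ | (K : ℝ) + 1 < ‖Y n p.1 p.2‖}
      ≤ (Q₁.prod Q₂) B + (Q₁.prod Q₂) G := (measure_mono hsub).trans (measure_union_le _ _)
    _ ≤ ENNReal.ofReal (ε / 4) + ENNReal.ofReal (ε / 2 + ε / 16) := by
        refine add_le_add ?_ hGP
        rw [hBdef, measure_toMeasurable]
        exact hn.trans (ENNReal.ofReal_le_ofReal (min_le_right _ _))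
    _ ≤ ENNReal.ofReal ε := by
        rw [← ENNReal.ofReal_add (by positivity) (by positivity)]
        exact ENNReal.ofReal_le_ofReal (by linarith)

/-- Lipschitz functionals of a conditionally convergent sequence are nearly measurable. -/
theorem CondWeakConv.nearMeasurable_comp [NormedAddCommGroup E] [MeasurableSpace E] [BorelSpace E]
    {Y : ℕ → Ω₁ → Ω₂ → E} {ν : Measure E} [IsProbabilityMeasure ν]
    (hY : ∀ n ω₁, Measurable (Y n ω₁)) (h : CondWeakConv Q₁ Q₂ Y ν) {φ : E → ℝ}
    (hφ : ∀ x y, |φ x - φ y| ≤ dist x y) (hφ' : ∀ x, |φ x| ≤ ‖x‖) :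
    NearMeasurable (Q₁.prod Q₂) (fun n p => φ (Y n p.1 p.2)) := by
  intro ε hε
  obtain ⟨K, hK1, hK⟩ := h.tight hY (half_pos hε)
  have hK0 : 0 < K := by linarith
  -- Clipping `φ / K` gives an admissible test function because `K ≥ 1`; it agrees with `φ / K` on
  -- the ball of radius `K`, which carries most of the mass.
  have hh : (fun y => max (min (φ y / K) 1) (-1)) ∈ BL1 E := by
    refine ⟨fun y => abs_le.2 ⟨le_max_right _ _, max_le (min_le_right _ _) (by norm_num)⟩,
      fun x y => ?_⟩
    refine (abs_max_sub_max_le_abs _ _ _).trans ((abs_min_sub_min_le_max _ _ _ _).trans ?_)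
    rw [sub_self, abs_zero, ← sub_div, abs_div, abs_of_pos hK0]
    exact max_le ((div_le_self (abs_nonneg _) hK1).trans (hφ x y)) dist_nonneg
  obtain ⟨V, hV, hVY⟩ := (condWeakConv_iff.1 h).2 _ hh (ε / (2 * K)) (by positivity)
  refine ⟨fun n p => K * V n p, fun n => (hV n).const_mul K, ?_⟩
  filter_upwards [hVY, hK] with n hn hn'
  calc (Q₁.prod Q₂) {p | ε ≤ dist (φ (Y n p.1 p.2)) (K * V n p)}
      ≤ (Q₁.prod Q₂) ({p | ε / (2 * K) ≤
          dist (max (min (φ (Y n p.1 p.2) / K) 1) (-1)) (V n p)} ∪ {p | K < ‖Y n p.1 p.2‖}) := by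
        refine measure_mono fun p hp => ?_
        by_contra hc
        simp only [Set.mem_union, Set.mem_ofPred_eq, not_or, not_le, not_lt] at hc hp
        obtain ⟨h1, h2⟩ := hc
        have h3 : |φ (Y n p.1 p.2) / K| ≤ 1 := by
          rw [abs_div, abs_of_pos hK0, div_le_one hK0]
          exact (hφ' _).trans h2
        rw [min_eq_left (abs_le.1 h3).2, max_eq_left (abs_le.1 h3).1, Real.dist_eq] at h1
        have h4 : dist (φ (Y n p.1 p.2)) (K * V n p) = K * |φ (Y n p.1 p.2) / K - V n p| := by
          rw [Real.dist_eq, ← abs_of_pos hK0, ← abs_mul, abs_of_pos hK0, mul_sub,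
            mul_div_cancel₀ _ hK0.ne']
        have h5 : K * |φ (Y n p.1 p.2) / K - V n p| < K * (ε / (2 * K)) := by gcongr
        have h6 : K * (ε / (2 * K)) = ε / 2 := by field_simp
        rw [h4] at hp
        linarith
    _ ≤ ENNReal.ofReal (ε / 2) + ENNReal.ofReal (ε / 2) := by
        refine (measure_union_le _ _).trans
          (add_le_add (hn.trans (ENNReal.ofReal_le_ofReal ?_)) hn')
        exact div_le_div_of_nonneg_left hε.le two_pos (by linarith)
    _ = ENNReal.ofReal ε := by
        rw [← ENNReal.ofReal_add (by positivity) (by positivity), add_halves]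

end CondWeakConv

/-! ### Perturbation of ordered eigenvalue decompositions -/

section Eigen

variable {r : ℕ}

namespace IsEigenDecomp

variable {S U V : Matrix (Fin r) (Fin r) ℝ} {d e : Fin r → ℝ}

theorem mul_transpose (h : IsEigenDecomp S U d) : U * U.transpose = 1 :=
  (Matrix.mem_orthogonalGroup_iff _ _).1 h.orthogonal

theorem transpose_mul (h : IsEigenDecomp S U d) : U.transpose * U = 1 :=
  (Matrix.mem_orthogonalGroup_iff' _ _).1 h.orthogonal

theorem abs_le_one (h : IsEigenDecomp S U d) (i j : Fin r) : |U i j| ≤ 1 :=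
  entry_norm_bound_of_unitary (𝕜 := ℝ) h.orthogonal i j

theorem sum_sq (h : IsEigenDecomp S U d) (k : Fin r) : ∑ i, U i k * U i k = 1 := by
  simpa [Matrix.mul_apply] using congrFun (congrFun h.transpose_mul k) k

theorem diagonal_eq (h : IsEigenDecomp S U d) :
    Matrix.diagonal d = U.transpose * S * U := by
  rw [h.eq]
  calc Matrix.diagonal d = (U.transpose * U) * Matrix.diagonal d * (U.transpose * U) := by
        rw [h.transpose_mul, one_mul, mul_one]
    _ = _ := by simp only [Matrix.mul_assoc]

theorem apply_eq (h : IsEigenDecomp S U d) (i : Fin r) : d i = (U.transpose * S * U) i i := by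
  rw [← h.diagonal_eq, Matrix.diagonal_apply_eq]

theorem nonneg (h : IsEigenDecomp S U d) (hS : S.PosSemidef) (i : Fin r) : 0 ≤ d i := by
  rw [h.apply_eq]
  have := (hS.conjTranspose_mul_mul_same U).diag_nonneg (i := i)
  rwa [Matrix.conjTranspose_eq_transpose_of_trivial] at this

/-- The characteristic polynomial determines the multiset of eigenvalues, and a decreasing sequence
is determined by how many entries lie above each level. -/
theorem eigenvalues_unique (h : IsEigenDecomp S U d) (h' : IsEigenDecomp S V e) : d = e := by
  have key : ∀ {W : Matrix (Fin r) (Fin r) ℝ} {f : Fin r → ℝ}, IsEigenDecomp S W f →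
      S.charpoly.roots = Multiset.map f Finset.univ.val := by
    intro W f hW
    rw [hW.eq, Matrix.charpoly_mul_comm, ← Matrix.mul_assoc, hW.transpose_mul, one_mul,
      Matrix.charpoly_diagonal]
    change (Multiset.map (fun i => Polynomial.X - Polynomial.C (f i)) Finset.univ.val).prod.roots = _
    have hmap := Multiset.map_map (fun a : ℝ => Polynomial.X - Polynomial.C a) f Finset.univ.val
    simp only [Function.comp_def] at hmap
    rw [← hmap, Polynomial.roots_multiset_prod_X_sub_C]
  have hm : Multiset.map d Finset.univ.val = Multiset.map e Finset.univ.val := by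
    rw [← key h, ← key h']
  have hcard : ∀ a : ℝ, (Finset.univ.filter fun i => a ≤ d i).card =
      (Finset.univ.filter fun i => a ≤ e i).card := by
    intro a
    have := congrArg (Multiset.countP (fun x => a ≤ x)) hm
    rw [Multiset.countP_map, Multiset.countP_map] at this
    exact this
  funext j
  refine le_antisymm ?_ ?_
  · rw [← Tuple.lt_card_ge_iff_apply_ge_of_antitone h'.antitone, ← hcard,
      Tuple.lt_card_ge_iff_apply_ge_of_antitone h.antitone]
  · rw [← Tuple.lt_card_ge_iff_apply_ge_of_antitone h.antitone, hcard,
      Tuple.lt_card_ge_iff_apply_ge_of_antitone h'.antitone]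

theorem rank_eq (h : IsEigenDecomp S U d) : S.rank = Fintype.card {i // d i ≠ 0} := by
  have hU : IsUnit U.det := by
    rw [← Matrix.isUnit_iff_isUnit_det]
    exact ⟨⟨U, U.transpose, h.mul_transpose, h.transpose_mul⟩, rfl⟩
  have hU' : IsUnit U.transpose.det := by rwa [Matrix.det_transpose]
  rw [h.eq, Matrix.rank_mul_eq_left_of_isUnit_det _ _ hU', Matrix.rank_mul_eq_right_of_isUnit_det _ _ hU,
    Matrix.rank_diagonal]

theorem pos_iff (h : IsEigenDecomp S U d) (hS : S.PosSemidef) (i : Fin r) :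
    0 < d i ↔ (i : ℕ) < S.rank := by
  rw [h.rank_eq, ← Tuple.lt_card_gt_iff_apply_gt_of_antitone h.antitone]
  rw [Fintype.card_subtype,
    Finset.filter_congr fun j _ => (h.nonneg hS j).lt_iff_ne'.trans Iff.rfl]

theorem eq_zero (h : IsEigenDecomp S U d) (hS : S.PosSemidef) {i : Fin r} (hi : S.rank ≤ i) :
    d i = 0 :=
  le_antisymm (not_lt.1 fun hlt => absurd ((h.pos_iff hS i).1 hlt) (not_lt.2 hi)) (h.nonneg hS i)

/-- The orthogonal matrix `V'U` commutes with the diagonal of eigenvalues, so simplicity of the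
`k`-th one kills the off-diagonal entries of column `k`; unit length leaves ±1. -/
theorem column_eq_or_neg (h : IsEigenDecomp S U d) (h' : IsEigenDecomp S V d) {k : Fin r}
    (hk : ∀ j, j ≠ k → d j ≠ d k) : (∀ i, V i k = U i k) ∨ ∀ i, V i k = -U i k := by
  set O := V.transpose * U with hO
  have hcomm : Matrix.diagonal d * O = O * Matrix.diagonal d := by
    calc Matrix.diagonal d * O = V.transpose * S * V * (V.transpose * U) := by
          rw [← h'.diagonal_eq]
      _ = V.transpose * S * (V * V.transpose) * U := by simp only [Matrix.mul_assoc]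
      _ = V.transpose * (U * U.transpose) * S * U := by
          rw [h'.mul_transpose, h.mul_transpose, mul_one, mul_one]
      _ = V.transpose * U * (U.transpose * S * U) := by simp only [Matrix.mul_assoc]
      _ = O * Matrix.diagonal d := by rw [← h.diagonal_eq]
  have hzero : ∀ j, j ≠ k → O j k = 0 := by
    intro j hj
    have := congrFun (congrFun hcomm j) k
    rw [Matrix.diagonal_mul, Matrix.mul_diagonal] at this
    have h2 : (d j - d k) * O j k = 0 := by linarith
    exact (mul_eq_zero.1 h2).resolve_left (sub_ne_zero.2 (hk j hj))
  have hUV : ∀ i, U i k = V i k * O k k := by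
    intro i
    have h1 : U = V * O := by
      rw [hO, ← Matrix.mul_assoc, h'.mul_transpose, one_mul]
    calc U i k = (V * O) i k := by rw [← h1]
      _ = ∑ j, V i j * O j k := Matrix.mul_apply
      _ = V i k * O k k := Finset.sum_eq_single k (fun j _ hj => by rw [hzero j hj, mul_zero])
          (fun hk => absurd (Finset.mem_univ k) hk)
  have hsq : O k k * O k k = 1 := by
    have h1 := h.sum_sq k
    have h2 : ∑ i, U i k * U i k = (∑ i, V i k * V i k) * (O k k * O k k) := by
      rw [Finset.sum_mul]
      exact Finset.sum_congr rfl fun i _ => by rw [hUV i]; ring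
    rw [h2, h'.sum_sq k, one_mul] at h1
    exact h1
  rcases mul_self_eq_one_iff.1 hsq with h1 | h1
  · exact Or.inl fun i => by rw [hUV i, h1, mul_one]
  · exact Or.inr fun i => by rw [hUV i, h1]; ring

end IsEigenDecomp

theorem exists_isEigenDecomp {S : Matrix (Fin r) (Fin r) ℝ} (hS : S.IsHermitian) :
    ∃ U d, IsEigenDecomp S U d := by
  classical
  set σ := Tuple.sort (fun i => -hS.eigenvalues i) with hσ
  have hmono := Tuple.monotone_sort (fun i => -hS.eigenvalues i)
  set U : Matrix (Fin r) (Fin r) ℝ := (hS.eigenvectorUnitary : Matrix (Fin r) (Fin r) ℝ) with hU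
  have hUm : U * U.transpose = 1 :=
    (Matrix.mem_orthogonalGroup_iff _ _).1 hS.eigenvectorUnitary.2
  have hspec : S = U * Matrix.diagonal hS.eigenvalues * U.transpose := by
    have := hS.spectral_theorem
    rw [Unitary.conjStarAlgAut_apply] at this
    exact this
  refine ⟨U.submatrix id σ, hS.eigenvalues ∘ σ, ?_, fun i j hij => ?_, ?_⟩
  · rw [Matrix.mem_orthogonalGroup_iff, Matrix.transpose_submatrix,
      Matrix.submatrix_mul_equiv, hUm, Matrix.submatrix_id_id]
  · have := hmono hij
    simp only [Function.comp_apply] at this ⊢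
    linarith
  · rw [← Matrix.submatrix_diagonal_equiv, Matrix.submatrix_mul_equiv, Matrix.transpose_submatrix,
      Matrix.submatrix_mul_equiv, Matrix.submatrix_id_id]
    exact hspec

/-- Eigenvalue decompositions of matrices near `S` are near eigenvalue decompositions of `S`. -/
theorem exists_isEigenDecomp_near (S : Matrix (Fin r) (Fin r) ℝ) {ε : ℝ} (hε : 0 < ε) :
    ∃ δ > 0, ∀ S' U' d', IsEigenDecomp S' U' d' → (∀ i j, |S' i j - S i j| < δ) →
      ∃ U d, IsEigenDecomp S U d ∧ (∀ i j, |U' i j - U i j| < ε) ∧ ∀ i, |d' i - d i| < ε := by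
  -- Compactness: counterexamples with `S' → S` have eigenvector matrices with entries in [-1, 1],
  -- so a subsequence converges. Its limit is again a decomposition of `S`, since the defining
  -- conditions are closed. No spectral gap is needed.
  by_contra hcon
  push Not at hcon
  choose S' U' d' hdec hclose hfar using fun n : ℕ => hcon (1 / ((n : ℝ) + 1)) (by positivity)
  have hS' : Tendsto S' atTop (𝓝 S) := by
    refine tendsto_pi_nhds.2 fun i => tendsto_pi_nhds.2 fun j => ?_
    rw [tendsto_iff_dist_tendsto_zero]
    exact squeeze_zero (fun _ => dist_nonneg) (fun n => (hclose n i j).le)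
      tendsto_one_div_add_atTop_nhds_zero_nat
  have hK : IsCompact (Set.univ.pi fun _ : Fin r => Set.univ.pi fun _ : Fin r =>
      Set.Icc (-1 : ℝ) 1) :=
    isCompact_univ_pi fun _ => isCompact_univ_pi fun _ => isCompact_Icc
  obtain ⟨U, -, φ, hφ, hU⟩ := IsCompact.tendsto_subseq (X := Fin r → Fin r → ℝ) hK
    (x := fun n => (U' n : Fin r → Fin r → ℝ))
    (fun n i _ j _ => abs_le.1 ((hdec n).abs_le_one i j))
  replace hU : Tendsto (fun n => U' (φ n)) atTop (𝓝 (U : Matrix (Fin r) (Fin r) ℝ)) := hU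
  set W : Matrix (Fin r) (Fin r) ℝ := U with hW
  have hS'' : Tendsto (fun n => S' (φ n)) atTop (𝓝 S) := hS'.comp hφ.tendsto_atTop
  have hUt : Tendsto (fun n => (U' (φ n)).transpose) atTop (𝓝 W.transpose) :=
    ((continuous_id.matrix_transpose).tendsto W).comp hU
  have hmat : Tendsto (fun n => (U' (φ n)).transpose * S' (φ n) * U' (φ n)) atTop
      (𝓝 (W.transpose * S * W)) := (hUt.mul hS'').mul hU
  have hd : Tendsto (fun n => d' (φ n)) atTop (𝓝 fun i => (W.transpose * S * W) i i) := by
    refine tendsto_pi_nhds.2 fun i => ?_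
    have := tendsto_pi_nhds.1 (tendsto_pi_nhds.1 hmat i) i
    exact this.congr fun n => ((hdec (φ n)).apply_eq i).symm
  set d : Fin r → ℝ := fun i => (W.transpose * S * W) i i with hddef
  have hdecS : IsEigenDecomp S W d := by
    refine ⟨(Matrix.mem_orthogonalGroup_iff _ _).2 ?_, fun i j hij => ?_, ?_⟩
    · refine tendsto_nhds_unique (hU.mul hUt) ?_
      exact tendsto_const_nhds.congr fun n => (hdec (φ n)).mul_transpose.symm
    · exact le_of_tendsto_of_tendsto' (tendsto_pi_nhds.1 hd j) (tendsto_pi_nhds.1 hd i)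
        fun n => (hdec (φ n)).antitone hij
    · have hdiag : Tendsto (fun n => Matrix.diagonal (d' (φ n))) atTop (𝓝 (Matrix.diagonal d)) :=
        ((continuous_id.matrix_diagonal).tendsto d).comp hd
      refine tendsto_nhds_unique hS'' (((hU.mul hdiag).mul hUt).congr fun n => ?_)
      exact (hdec (φ n)).eq.symm
  have h1 : ∀ᶠ n in atTop, ∀ i j, |U' (φ n) i j - W i j| < ε := by
    refine eventually_all.2 fun i => eventually_all.2 fun j => ?_
    exact (Metric.tendsto_nhds.1 (tendsto_pi_nhds.1 (tendsto_pi_nhds.1 hU i) j)) ε hε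
  have h2 : ∀ᶠ n in atTop, ∀ i, |d' (φ n) i - d i| < ε := by
    refine eventually_all.2 fun i => ?_
    exact (Metric.tendsto_nhds.1 (tendsto_pi_nhds.1 hd i)) ε hε
  obtain ⟨n, hn1, hn2⟩ := (h1.and h2).exists
  obtain ⟨i, hi⟩ := hfar (φ n) W d hdecS hn1
  exact absurd (hn2 i) (not_lt.2 hi)

/-- The diagonal entries of `diag(d)^{1/2} (diag(dπ)^{1/2})^+`. -/
noncomputable def sqrtRatio (d dπ : Fin r → ℝ) (k : Fin r) : ℝ :=
  Real.sqrt (d k) * (Real.sqrt (dπ k))⁻¹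

/-- The sign aligning the `k`-th column of `U` with the `k`-th column of `U'`. -/
noncomputable def alignSign (U U' : Matrix (Fin r) (Fin r) ℝ) (k : Fin r) : ℝ :=
  if 0 ≤ ∑ j, U' j k * U j k then 1 else -1

theorem alignSign_eq (U U' : Matrix (Fin r) (Fin r) ℝ) (k : Fin r) :
    alignSign U U' k = 1 ∨ alignSign U U' k = -1 := by
  unfold alignSign
  split_ifs <;> simp

/-- The `k`-th column of `V` is ± that of `U`, and the inner product defining `alignSign` differs
from this ±1 by less than 1, so its sign picks the right alternative. -/
theorem abs_sub_alignSign_lt {S U V U' : Matrix (Fin r) (Fin r) ℝ} {d : Fin r → ℝ}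
    (h : IsEigenDecomp S U d) (h' : IsEigenDecomp S V d) {k : Fin r}
    (hk : ∀ j, j ≠ k → d j ≠ d k) {e : ℝ} (he : r * e < 1)
    (hV : ∀ i j, |U' i j - V i j| < e) (j : Fin r) :
    |U' j k - alignSign U U' k * U j k| < e := by
  have herr : |∑ j, (U' j k - V j k) * U j k| < 1 := by
    refine lt_of_le_of_lt (Finset.abs_sum_le_sum_abs _ _) (lt_of_le_of_lt ?_ he)
    refine (Finset.sum_le_card_nsmul Finset.univ _ e fun j _ => ?_).trans (by simp)
    rw [abs_mul]
    nlinarith [hV j k, h.abs_le_one j k, abs_nonneg (U' j k - V j k), abs_nonneg (U j k)]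
  have hsplit : ∑ j, U' j k * U j k = ∑ j, (U' j k - V j k) * U j k + ∑ j, V j k * U j k := by
    rw [← Finset.sum_add_distrib]
    exact Finset.sum_congr rfl fun j _ => by ring
  rcases h.column_eq_or_neg h' hk with hs | hs
  · have h1 : ∑ j, V j k * U j k = 1 := by
      rw [← h.sum_sq k]; exact Finset.sum_congr rfl fun i _ => by rw [hs i]
    have h2 : alignSign U U' k = 1 := by
      unfold alignSign
      rw [if_pos]
      linarith [(abs_lt.1 herr).1]
    rw [h2, one_mul, ← hs j]
    exact hV j k
  · have h1 : ∑ j, V j k * U j k = -1 := by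
      rw [← h.sum_sq k, ← Finset.sum_neg_distrib]
      exact Finset.sum_congr rfl fun i _ => by rw [hs i]; ring
    have h2 : alignSign U U' k = -1 := by
      unfold alignSign
      rw [if_neg]
      linarith [(abs_lt.1 herr).2]
    rw [h2, neg_one_mul, ← hs j]
    exact hV j k

/-- Below the rank of `Sπ` the limiting denominator is positive, so the ratio is continuous there
and the eigenvector is determined up to sign. From the rank on, all ratios vanish identically. The
factor `sqrtRatio d dπ k` in the second bound discards the eigenvectors of the kernel, which need
not stabilise. -/
theorem exists_perturbation_bound {S Sπ U Uπ : Matrix (Fin r) (Fin r) ℝ} {d dπ : Fin r → ℝ}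
    (hS : S.PosSemidef) (hSπ : Sπ.PosSemidef) (hU : IsEigenDecomp S U d)
    (hUπ : IsEigenDecomp Sπ Uπ dπ) (hrank : S.rank ≤ Sπ.rank)
    (hdistinct : StrictAntiOn dπ {i | (i : ℕ) < Sπ.rank}) {η : ℝ} (hη : 0 < η) :
    ∃ δ > 0, ∀ S' U' d' Sπ' Uπ' dπ', S'.PosSemidef → Sπ'.PosSemidef →
      IsEigenDecomp S' U' d' → IsEigenDecomp Sπ' Uπ' dπ' →
      (∀ i j, |S' i j - S i j| < δ) → (∀ i j, |Sπ' i j - Sπ i j| < δ) →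
      min S'.rank Sπ'.rank ≤ Sπ.rank →
      (∀ k, |sqrtRatio d' dπ' k - sqrtRatio d dπ k| < η) ∧
      ∀ j k, |sqrtRatio d dπ k * (Uπ' j k - alignSign Uπ Uπ' k * Uπ j k)| < η := by
  have hev1 : ∀ k : Fin r, (k : ℕ) < Sπ.rank → ∀ᶠ e in 𝓝[>] (0 : ℝ), ∀ x y : ℝ,
      |x - d k| < e → |y - dπ k| < e →
      |Real.sqrt x * (Real.sqrt y)⁻¹ - sqrtRatio d dπ k| < η := by
    intro k hk
    have hpos : 0 < dπ k := (hUπ.pos_iff hSπ k).2 hk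
    have hc : ContinuousAt (fun p : ℝ × ℝ => Real.sqrt p.1 * (Real.sqrt p.2)⁻¹) (d k, dπ k) := by
      refine ContinuousAt.mul (by fun_prop) (ContinuousAt.inv₀ (by fun_prop) ?_)
      exact (Real.sqrt_pos.2 hpos).ne'
    obtain ⟨e₀, he₀, h⟩ := Metric.continuousAt_iff.1 hc η hη
    filter_upwards [Ioo_mem_nhdsGT he₀] with e he x y hx hy
    refine h (x := (x, y)) ?_
    rw [Prod.dist_eq, max_lt_iff]
    exact ⟨hx.trans he.2, hy.trans he.2⟩
  have hev2 : ∀ c : ℝ, ∀ a > 0, ∀ᶠ e in 𝓝[>] (0 : ℝ), c * e < a := by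
    intro c a ha
    have : Tendsto (fun e : ℝ => c * e) (𝓝[>] 0) (𝓝 0) := by
      have : Tendsto (fun e : ℝ => c * e) (𝓝 0) (𝓝 (c * 0)) := tendsto_id.const_mul c
      rw [mul_zero] at this
      exact this.mono_left nhdsWithin_le_nhds
    exact this.eventually_lt_const ha
  have hev3 : ∀ᶠ e in 𝓝[>] (0 : ℝ), ∀ k : Fin r, (k : ℕ) < Sπ.rank → ∀ x y : ℝ,
      |x - d k| < e → |y - dπ k| < e →
      |Real.sqrt x * (Real.sqrt y)⁻¹ - sqrtRatio d dπ k| < η := by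
    refine eventually_all.2 fun k => ?_
    by_cases hk : (k : ℕ) < Sπ.rank
    · exact (hev1 k hk).mono fun e he _ => he
    · exact Eventually.of_forall fun e h => absurd h hk
  obtain ⟨e, ⟨⟨he1, he2⟩, he3⟩, he0⟩ := (((hev3.and (eventually_all.2 fun k =>
    hev2 |sqrtRatio d dπ k| η hη)).and (hev2 r 1 one_pos)).and self_mem_nhdsWithin).exists
  replace he0 : 0 < e := he0
  obtain ⟨δ₁, hδ₁, hnear⟩ := exists_isEigenDecomp_near S he0
  obtain ⟨δ₂, hδ₂, hnearπ⟩ := exists_isEigenDecomp_near Sπ he0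
  refine ⟨min δ₁ δ₂, lt_min hδ₁ hδ₂, ?_⟩
  intro S' U' d' Sπ' Uπ' dπ' hS' hSπ' hdec hdecπ hclose hcloseπ hmin
  obtain ⟨U₀, d₀, hU₀, -, hd₀⟩ := hnear S' U' d' hdec
    fun i j => (hclose i j).trans_le (min_le_left _ _)
  obtain ⟨Uπ₀, dπ₀, hUπ₀, hUclose, hdπ₀⟩ := hnearπ Sπ' Uπ' dπ' hdecπ
    fun i j => (hcloseπ i j).trans_le (min_le_right _ _)
  -- The nearby decompositions of `S` and `Sπ` may have other eigenvectors, but they have the same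
  -- ordered eigenvalues.
  obtain rfl := hU.eigenvalues_unique hU₀
  obtain rfl := hUπ.eigenvalues_unique hUπ₀
  have hzero : ∀ k : Fin r, Sπ.rank ≤ k → sqrtRatio d dπ k = 0 := fun k hk => by
    unfold sqrtRatio
    rw [hU.eq_zero hS (hrank.trans hk), Real.sqrt_zero, zero_mul]
  refine ⟨fun k => ?_, fun j k => ?_⟩
  · by_cases hk : (k : ℕ) < Sπ.rank
    · exact he1 k hk _ _ (hd₀ k) (hdπ₀ k)
    · rw [not_lt] at hk
      have : sqrtRatio d' dπ' k = 0 := by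
        unfold sqrtRatio
        -- Either the numerator is zero, or the denominator is zero and its pseudo-inverse vanishes.
        rcases min_le_iff.1 hmin with h | h
        · rw [hdec.eq_zero hS' (h.trans hk), Real.sqrt_zero, zero_mul]
        · rw [hdecπ.eq_zero hSπ' (h.trans hk), Real.sqrt_zero, inv_zero, mul_zero]
      rw [this, hzero k hk, sub_zero, abs_zero]
      exact hη
  · by_cases hk : (k : ℕ) < Sπ.rank
    · have hsimple : ∀ i, i ≠ k → dπ i ≠ dπ k := by
        intro i hi
        by_cases hir : (i : ℕ) < Sπ.rank
        · exact fun heq => hi (hdistinct.injOn hir hk heq)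
        · rw [hUπ.eq_zero hSπ (not_lt.1 hir)]
          exact ((hUπ.pos_iff hSπ k).2 hk).ne
      rw [abs_mul]
      refine lt_of_le_of_lt ?_ (he2 k)
      exact mul_le_mul_of_nonneg_left
        (abs_sub_alignSign_lt hUπ hUπ₀ hsimple he3 hUclose j).le (abs_nonneg _)
    · rw [hzero k (not_lt.1 hk), zero_mul, abs_zero]
      exact hη

theorem norm_toEuclideanCLM_apply_le {A : Matrix (Fin r) (Fin r) ℝ} {c : ℝ}
    (hA : ∀ i j, |A i j| ≤ c) (x : EuclideanSpace ℝ (Fin r)) :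
    ‖Matrix.toEuclideanCLM (𝕜 := ℝ) A x‖ ≤ r * (r * c) * ‖x‖ := by
  rcases Nat.eq_zero_or_pos r with rfl | hr
  · simp [Subsingleton.elim (Matrix.toEuclideanCLM (𝕜 := ℝ) A x) 0]
  have hc : 0 ≤ c := (abs_nonneg _).trans (hA ⟨0, hr⟩ ⟨0, hr⟩)
  have hr1 : (1 : ℝ) ≤ r := by exact_mod_cast hr
  have hcoord : ∀ i, |Matrix.toEuclideanCLM (𝕜 := ℝ) A x i| ≤ r * c * ‖x‖ := by
    intro i
    have : Matrix.toEuclideanCLM (𝕜 := ℝ) A x i = ∑ j, A i j * x j := rfl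
    rw [this]
    refine (Finset.abs_sum_le_sum_abs _ _).trans
      ((Finset.sum_le_card_nsmul Finset.univ _ (c * ‖x‖) fun j _ => ?_).trans ?_)
    · rw [abs_mul]
      exact mul_le_mul (hA i j) (PiLp.norm_apply_le x j) (abs_nonneg _) hc
    · simp [mul_assoc]
  rw [EuclideanSpace.norm_eq]
  refine Real.sqrt_le_iff.2 ⟨by positivity, ?_⟩
  refine (Finset.sum_le_card_nsmul Finset.univ _ ((r * c * ‖x‖) ^ 2) fun i _ => ?_).trans ?_
  · rw [Real.norm_eq_abs]
    exact pow_le_pow_left₀ (abs_nonneg _) (hcoord i) 2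
  · simp only [Finset.card_univ, Fintype.card_fin, nsmul_eq_mul]
    have : (r : ℝ) * (r * c) * ‖x‖ = r * (r * c * ‖x‖) := by ring
    rw [this, mul_pow (r : ℝ)]
    exact mul_le_mul_of_nonneg_right (by nlinarith) (sq_nonneg _)

theorem abs_apply_le_specNorm (A : Matrix (Fin r) (Fin r) ℝ) (i j : Fin r) :
    |A i j| ≤ specNorm A := by
  have h1 : Matrix.toEuclideanCLM (𝕜 := ℝ) A (EuclideanSpace.single j 1) i = A i j := by
    rw [Matrix.ofLp_toEuclideanCLM]
    simp
  have h2 := PiLp.norm_apply_le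
    (Matrix.toEuclideanCLM (𝕜 := ℝ) A (EuclideanSpace.single j 1)) i
  have h3 := (Matrix.toEuclideanCLM (𝕜 := ℝ) A).le_opNorm (EuclideanSpace.single j 1)
  simp only [PiLp.norm_single, norm_one, mul_one] at h3
  rw [h1, Real.norm_eq_abs] at h2
  exact h2.trans h3

/-- The pseudo-inverse of a diagonal matrix inverts entrywise with `0⁻¹ = 0`, so the middle factors
merge into one diagonal of signed ratios. -/
theorem corrected_eq (U : Matrix (Fin r) (Fin r) ℝ) (d : Fin r → ℝ)
    (Uπ : Matrix (Fin r) (Fin r) ℝ) (dπ s : Fin r → ℝ) (θ : EuclideanSpace ℝ (Fin r)) :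
    corrected U d Uπ dπ s θ = Matrix.toEuclideanCLM (𝕜 := ℝ)
      (U * Matrix.diagonal (fun k => sqrtRatio d dπ k * s k) * Uπ.transpose) θ := by
  unfold corrected sqrtDiag
  rw [pinv_diagonal, Matrix.mul_assoc U, Matrix.diagonal_mul_diagonal, Matrix.mul_assoc U,
    Matrix.diagonal_mul_diagonal]
  rfl

theorem mul_diagonal_mul_transpose_apply (U V : Matrix (Fin r) (Fin r) ℝ) (v : Fin r → ℝ)
    (i j : Fin r) :
    (U * Matrix.diagonal v * V.transpose) i j = ∑ k, U i k * v k * V j k := by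
  rw [Matrix.mul_apply]
  simp only [Matrix.mul_diagonal, Matrix.transpose_apply]

end Eigen

/-! ### Linear images of Gaussian laws -/

section Gaussian

variable {r : ℕ}

/-- Characteristic functions agree since ‖B't‖² = t'BB't. Any factor `B` of the covariance may thus
be used, and equality of Gaussian laws reduces to a matrix identity. -/
theorem multivariateGaussian_mul_transpose (B : Matrix (Fin r) (Fin r) ℝ) :
    multivariateGaussian 0 (B * B.transpose) =
      (stdGaussian (EuclideanSpace ℝ (Fin r))).map (Matrix.toEuclideanCLM (𝕜 := ℝ) B) := by
  have hpsd : (B * B.transpose).PosSemidef := by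
    have := Matrix.posSemidef_self_mul_conjTranspose B
    rwa [Matrix.conjTranspose_eq_transpose_of_trivial] at this
  set T := Matrix.toEuclideanCLM (𝕜 := ℝ) B with hT
  have : IsProbabilityMeasure ((stdGaussian (EuclideanSpace ℝ (Fin r))).map T) :=
    Measure.isProbabilityMeasure_map T.continuous.measurable.aemeasurable
  refine Measure.ext_of_charFun ?_
  funext t
  have hadj : ContinuousLinearMap.adjoint T = Matrix.toEuclideanCLM (𝕜 := ℝ) B.transpose := by
    rw [hT, ← ContinuousLinearMap.star_eq_adjoint, ← map_star, Matrix.star_eq_conjTranspose,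
      Matrix.conjTranspose_eq_transpose_of_trivial]
  have hmap : charFun ((stdGaussian (EuclideanSpace ℝ (Fin r))).map T) t =
      charFun (stdGaussian (EuclideanSpace ℝ (Fin r))) (ContinuousLinearMap.adjoint T t) := by
    rw [charFun_apply, charFun_apply, integral_map T.continuous.measurable.aemeasurable
      (by fun_prop)]
    simp only [ContinuousLinearMap.adjoint_inner_right]
  have hnorm : ‖ContinuousLinearMap.adjoint T t‖ ^ 2 =
      dotProduct t ((B * B.transpose).mulVec t) := by
    rw [← Matrix.inner_toEuclideanCLM, map_mul, ← hT, ← hadj, mul_apply_eq_comp,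
      ← ContinuousLinearMap.adjoint_inner_left, real_inner_self_eq_norm_sq]
  rw [charFun_multivariateGaussian hpsd, hmap, charFun_stdGaussian, ← hnorm]
  simp [neg_div]

theorem multivariateGaussian_eq_map {S U : Matrix (Fin r) (Fin r) ℝ} {d : Fin r → ℝ}
    (hS : S.PosSemidef) (hU : IsEigenDecomp S U d) :
    multivariateGaussian 0 S = (stdGaussian (EuclideanSpace ℝ (Fin r))).map
      (Matrix.toEuclideanCLM (𝕜 := ℝ) (U * sqrtDiag d)) := by
  rw [← multivariateGaussian_mul_transpose]
  congr 1
  rw [hU.eq, Matrix.transpose_mul, sqrtDiag, Matrix.diagonal_transpose, Matrix.mul_assoc U,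
    Matrix.mul_assoc U, ← Matrix.mul_assoc (Matrix.diagonal _) (Matrix.diagonal _),
    Matrix.diagonal_mul_diagonal]
  congr 3
  funext k
  exact (Real.mul_self_sqrt (hU.nonneg hS k)).symm

/-- The signs square to 1 in the covariance, so the image law does not depend on `s`. The hypothesis
`hd` covers the coordinates where the ratio is 0 by convention. -/
theorem map_multivariateGaussian {Sπ Uπ : Matrix (Fin r) (Fin r) ℝ} {d dπ : Fin r → ℝ}
    (hSπ : Sπ.PosSemidef) (hUπ : IsEigenDecomp Sπ Uπ dπ) (hd : ∀ k, dπ k = 0 → d k = 0)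
    (V : Matrix (Fin r) (Fin r) ℝ) {s : Fin r → ℝ} (hs : ∀ k, s k = 1 ∨ s k = -1) :
    (multivariateGaussian 0 Sπ).map (Matrix.toEuclideanCLM (𝕜 := ℝ)
        (V * Matrix.diagonal (fun k => sqrtRatio d dπ k * s k) * Uπ.transpose)) =
      (stdGaussian (EuclideanSpace ℝ (Fin r))).map
        (Matrix.toEuclideanCLM (𝕜 := ℝ) (V * sqrtDiag d)) := by
  rw [multivariateGaussian_eq_map hSπ hUπ, Measure.map_map
    (ContinuousLinearMap.continuous _).measurable (ContinuousLinearMap.continuous _).measurable,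
    ← ContinuousLinearMap.coe_comp, ← ContinuousLinearMap.mul_def, ← map_mul,
    ← multivariateGaussian_mul_transpose, ← multivariateGaussian_mul_transpose]
  congr 1
  have h1 : V * Matrix.diagonal (fun k => sqrtRatio d dπ k * s k) * Uπ.transpose *
      (Uπ * sqrtDiag dπ) = V * Matrix.diagonal (fun k => Real.sqrt (d k) * s k) := by
    rw [Matrix.mul_assoc, ← Matrix.mul_assoc Uπ.transpose, hUπ.transpose_mul, one_mul,
      Matrix.mul_assoc, sqrtDiag, Matrix.diagonal_mul_diagonal]
    congr 2
    funext k
    unfold sqrtRatio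
    rcases eq_or_ne (dπ k) 0 with h | h
    · rw [hd k h, h]; simp
    · have : Real.sqrt (dπ k) ≠ 0 :=
        (Real.sqrt_pos.2 (lt_of_le_of_ne (hUπ.nonneg hSπ k) h.symm)).ne'
      field_simp
  rw [h1, Matrix.transpose_mul, Matrix.transpose_mul, sqrtDiag, Matrix.diagonal_transpose,
    Matrix.diagonal_transpose, Matrix.mul_assoc V, Matrix.mul_assoc V,
    ← Matrix.mul_assoc (Matrix.diagonal _) (Matrix.diagonal _), Matrix.diagonal_mul_diagonal,
    ← Matrix.mul_assoc (Matrix.diagonal _) (Matrix.diagonal _), Matrix.diagonal_mul_diagonal]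
  congr 3
  funext k
  rcases hs k with h | h <;> rw [h] <;> ring

/-- Both laws are coupled as images of the same standard Gaussian vector. -/
theorem abs_integral_map_sub_le {h : EuclideanSpace ℝ (Fin r) → ℝ}
    (hh : h ∈ BL1 (EuclideanSpace ℝ (Fin r))) {A B : Matrix (Fin r) (Fin r) ℝ} {c : ℝ}
    (hAB : ∀ i j, |A i j - B i j| ≤ c) :
    |∫ x, h x ∂((stdGaussian (EuclideanSpace ℝ (Fin r))).map (Matrix.toEuclideanCLM (𝕜 := ℝ) A)) -
      ∫ x, h x ∂((stdGaussian (EuclideanSpace ℝ (Fin r))).map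
        (Matrix.toEuclideanCLM (𝕜 := ℝ) B))| ≤
      r * (r * c) * ∫ x, ‖x‖ ∂(stdGaussian (EuclideanSpace ℝ (Fin r))) := by
  have hc := continuous_of_mem_BL1 hh
  have hi : ∀ C : Matrix (Fin r) (Fin r) ℝ, Integrable
      (fun x => h (Matrix.toEuclideanCLM (𝕜 := ℝ) C x))
      (stdGaussian (EuclideanSpace ℝ (Fin r))) := fun C =>
    Integrable.of_bound (hc.comp (ContinuousLinearMap.continuous _)).aestronglyMeasurable 1
      (ae_of_all _ fun x => hh.1 _)
  rw [integral_map (ContinuousLinearMap.continuous _).measurable.aemeasurable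
      hc.aestronglyMeasurable,
    integral_map (ContinuousLinearMap.continuous _).measurable.aemeasurable
      hc.aestronglyMeasurable, ← integral_sub (hi A) (hi B), ← Real.norm_eq_abs,
    ← integral_const_mul]
  refine norm_integral_le_of_norm_le (IsGaussian.integrable_id.norm.const_mul _)
    (ae_of_all _ fun x => ?_)
  refine (hh.2 _ _).trans ?_
  rw [dist_eq_norm, ← sub_apply, ← map_sub]
  exact norm_toEuclideanCLM_apply_le hAB x

end Gaussian

/-! ### Sign symmetry of Rademacher vectors -/

section Rademacher

variable {Ω : Type*} [MeasurableSpace Ω] {r : ℕ} {Q : Measure Ω} [IsProbabilityMeasure Q]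
  {R : Fin r → Ω → ℝ}

theorem IsIIDRademacher.ae_eq (hR : IsIIDRademacher Q R) (i : Fin r) :
    ∀ᵐ ω ∂Q, R i ω = 1 ∨ R i ω = -1 := by
  have hm : ∀ a : ℝ, MeasurableSet {ω | R i ω = a} := fun a =>
    hR.measurable i (measurableSet_singleton a)
  have hdisj : Disjoint {ω | R i ω = 1} {ω | R i ω = -1} := by
    rw [Set.disjoint_left]
    intro ω h1 h2
    change R i ω = 1 at h1
    change R i ω = -1 at h2
    linarith
  have hone : Q ({ω | R i ω = 1} ∪ {ω | R i ω = -1}) = 1 := by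
    rw [measure_union hdisj (hm _), hR.prob_one, hR.prob_neg_one]
    exact ENNReal.add_halves 1
  exact (prob_compl_eq_zero_iff ((hm 1).union (hm (-1)))).2 hone

theorem IsIIDRademacher.map_neg (hR : IsIIDRademacher Q R) (i : Fin r) :
    (Q.map (R i)).map (fun x => -1 * x) = Q.map (R i) := by
  have h1 : Q.map (R i) = Q.map (fun ω => if R i ω = 1 then 1 else -1) := by
    refine Measure.map_congr ?_
    filter_upwards [hR.ae_eq i] with ω hω
    rcases hω with h | h <;> rw [h] <;> norm_num
  have hset : ∀ a : ℝ, MeasurableSet {ω | R i ω = a} := fun a =>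
    hR.measurable i (measurableSet_singleton a)
  ext A hA
  rw [Measure.map_map (measurable_const_mul _) (hR.measurable i),
    Measure.map_apply ((measurable_const_mul _).comp (hR.measurable i)) hA,
    Measure.map_apply (hR.measurable i) hA]
  have hsplit : ∀ B : Set ℝ, MeasurableSet B → Q (R i ⁻¹' B) =
      B.indicator (fun _ => 1 / 2) (1 : ℝ) + B.indicator (fun _ => 1 / 2) (-1 : ℝ) := by
    intro B hB
    have h2 : Q (R i ⁻¹' B) = Q ((R i ⁻¹' B) ∩ {ω | R i ω = 1}) +
        Q ((R i ⁻¹' B) ∩ {ω | R i ω = -1}) := by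
      rw [← measure_inter_add_sdiff (R i ⁻¹' B) (hset 1)]
      congr 1
      refine measure_congr ?_
      filter_upwards [hR.ae_eq i] with ω hω
      refine propext ?_
      change (R i ω ∈ B ∧ ¬ R i ω = 1) ↔ (R i ω ∈ B ∧ R i ω = -1)
      refine and_congr_right fun _ => ⟨fun h => hω.resolve_left h, fun h h' => ?_⟩
      rw [h'] at h
      norm_num at h
    have h3 : ∀ a : ℝ, Q {ω | R i ω = a} = 1 / 2 →
        Q ((R i ⁻¹' B) ∩ {ω | R i ω = a}) = B.indicator (fun _ => 1 / 2) a := by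
      intro a ha
      by_cases haB : a ∈ B
      · rw [Set.indicator_of_mem haB, ← ha]
        congr 1
        ext ω
        exact ⟨fun h => h.2, fun h => ⟨by change R i ω ∈ B; rw [show R i ω = a from h]; exact haB, h⟩⟩
      · rw [Set.indicator_of_notMem haB]
        convert measure_empty (μ := Q)
        ext ω
        refine ⟨fun h => haB ?_, fun h => h.elim⟩
        have h4 : R i ω ∈ B := h.1
        rwa [show R i ω = a from h.2] at h4
    rw [h2, h3 1 (hR.prob_one i), h3 (-1) (hR.prob_neg_one i)]
  have hpre : (fun x => -1 * x) ∘ R i ⁻¹' A = R i ⁻¹' ((fun x => -1 * x) ⁻¹' A) := rfl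
  rw [hpre, hsplit _ (measurable_const_mul (-1) hA), hsplit A hA, add_comm]
  have h5 : ∀ a : ℝ, ((fun x : ℝ => -1 * x) ⁻¹' A).indicator (fun _ => (1 / 2 : ℝ≥0∞)) a =
      A.indicator (fun _ => (1 / 2 : ℝ≥0∞)) (-1 * a) := fun a => rfl
  rw [h5, h5]
  norm_num

/-- The law of a Rademacher vector is invariant under sign flips of the coordinates. -/
theorem IsIIDRademacher.map_mul (hR : IsIIDRademacher Q R) {e : Fin r → ℝ}
    (he : ∀ k, e k = 1 ∨ e k = -1) :
    (Q.map (fun ω k => R k ω)).map (fun s k => e k * s k) = Q.map (fun ω k => R k ω) := by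
  have hprob : ∀ k, IsProbabilityMeasure (Q.map (R k)) := fun k =>
    Measure.isProbabilityMeasure_map (hR.measurable k).aemeasurable
  have h1 : ∀ k, (Q.map (R k)).map (fun x => e k * x) = Q.map (R k) := by
    intro k
    rcases he k with h | h <;> rw [h]
    · simp
    · exact hR.map_neg k
  have hprob' : ∀ k, IsProbabilityMeasure ((Q.map (R k)).map (fun x => e k * x)) := fun k => by
    rw [h1 k]; exact hprob k
  rw [(iIndepFun_iff_map_fun_eq_pi_map fun k => (hR.measurable k).aemeasurable).1 hR.indep,
    Measure.pi_map_pi (f := fun k x => e k * x) fun k => (measurable_const_mul _).aemeasurable]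
  simp only [h1]

end Rademacher

/-! ### Conditional law of the sign-aligned estimator -/

section ConditionalLaw

variable {Ω χ : Type*} [MeasurableSpace Ω] [MeasurableSpace χ] {r : ℕ} {Q : Measure Ω}
  [IsProbabilityMeasure Q] {R : Fin r → Ω → ℝ} {M : Ω → χ}

theorem continuous_toEuclideanCLM_apply {X : Type*} [TopologicalSpace X]
    {A : X → Matrix (Fin r) (Fin r) ℝ} {y : X → EuclideanSpace ℝ (Fin r)} (hA : Continuous A)
    (hy : Continuous y) : Continuous fun x => Matrix.toEuclideanCLM (𝕜 := ℝ) (A x) (y x) :=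
  (PiLp.continuous_toLp 2 _).comp
    (hA.matrix_mulVec ((PiLp.continuous_ofLp 2 _).comp hy))

theorem continuous_signed_apply (U V : Matrix (Fin r) (Fin r) ℝ) (g : Fin r → ℝ) :
    Continuous fun p : (Fin r → ℝ) × EuclideanSpace ℝ (Fin r) =>
      Matrix.toEuclideanCLM (𝕜 := ℝ)
        (U * Matrix.diagonal (fun k => g k * p.1 k) * V.transpose) p.2 := by
  have h : Continuous fun p : (Fin r → ℝ) × EuclideanSpace ℝ (Fin r) => fun k => g k * p.1 k :=
    continuous_pi fun k => continuous_const.mul ((continuous_apply k).comp continuous_fst)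
  exact continuous_toEuclideanCLM_apply
    ((continuous_const.matrix_mul h.matrix_diagonal).matrix_mul continuous_const) continuous_snd

theorem measurable_signed_apply {X : Type*} [MeasurableSpace X] (U V : Matrix (Fin r) (Fin r) ℝ)
    (g : Fin r → ℝ) {s : X → Fin r → ℝ} {y : X → EuclideanSpace ℝ (Fin r)} (hs : Measurable s)
    (hy : Measurable y) :
    Measurable fun x => Matrix.toEuclideanCLM (𝕜 := ℝ)
      (U * Matrix.diagonal (fun k => g k * s x k) * V.transpose) (y x) := by
  have := (continuous_signed_apply U V g).measurable.comp (hs.prodMk hy)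
  simpa only [Function.comp_def] using this

/-- For each frozen value `m` the flip by `e m` preserves the law of `R`. By Fubini the flipped
signs may be replaced by signs independent of `M`, however `e` depends on `M`. -/
theorem integral_signed_eq (hR : IsIIDRademacher Q R) (hM : Measurable M)
    (hRM : IndepFun (fun ω k => R k ω) M Q) {F : Type*} [MeasurableSpace F] {y : χ → F}
    (hy : Measurable y) {e : χ → Fin r → ℝ} (hem : ∀ k, Measurable fun m => e m k)
    (he : ∀ m k, e m k = 1 ∨ e m k = -1) {f : (Fin r → ℝ) × F → ℝ} (hf : Measurable f)
    (hf1 : ∀ p, |f p| ≤ 1) :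
    ∫ ω, f (fun k => R k ω * e (M ω) k, y (M ω)) ∂Q =
      ∫ s, ∫ ω, f (s, y (M ω)) ∂Q ∂(Q.map fun ω k => R k ω) := by
  have hRm : Measurable fun ω k => R k ω := measurable_pi_lambda _ hR.measurable
  set μ := Q.map fun ω k => R k ω with hμ
  set κ := Q.map M with hκ
  have : IsProbabilityMeasure μ := Measure.isProbabilityMeasure_map hRm.aemeasurable
  have : IsProbabilityMeasure κ := Measure.isProbabilityMeasure_map hM.aemeasurable
  have hprod : Q.map (fun ω => ((fun k => R k ω), M ω)) = μ.prod κ :=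
    (indepFun_iff_map_prod_eq_prod_map_map hRm.aemeasurable hM.aemeasurable).1 hRM
  have hG : Measurable fun p : (Fin r → ℝ) × χ => f (fun k => p.1 k * e p.2 k, y p.2) := by
    refine hf.comp (Measurable.prodMk (measurable_pi_lambda _ fun k => ?_)
      (hy.comp measurable_snd))
    exact ((measurable_pi_apply k).comp measurable_fst).mul ((hem k).comp measurable_snd)
  have hH : Measurable fun p : (Fin r → ℝ) × χ => f (p.1, y p.2) :=
    hf.comp (measurable_fst.prodMk (hy.comp measurable_snd))
  calc ∫ ω, f (fun k => R k ω * e (M ω) k, y (M ω)) ∂Q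
      = ∫ p, f (fun k => p.1 k * e p.2 k, y p.2) ∂(μ.prod κ) := by
        rw [← hprod, integral_map (hRm.prodMk hM).aemeasurable hG.aestronglyMeasurable]
    _ = ∫ m, ∫ s, f (fun k => s k * e m k, y m) ∂μ ∂κ :=
        integral_prod_symm _ (Integrable.of_bound hG.aestronglyMeasurable 1
          (ae_of_all _ fun p => hf1 _))
    _ = ∫ m, ∫ s, f (s, y m) ∂μ ∂κ := by
        refine integral_congr_ae (ae_of_all _ fun m => ?_)
        change ∫ s, f (fun k => s k * e m k, y m) ∂μ = ∫ s, f (s, y m) ∂μ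
        conv_rhs => rw [hμ, ← hR.map_mul (he m)]
        have hms : Measurable fun s : Fin r → ℝ => f (s, y m) := hf.comp measurable_prodMk_right
        have hflip : Measurable fun (s : Fin r → ℝ) (k : Fin r) => e m k * s k :=
          measurable_pi_lambda _ fun k => (measurable_pi_apply k).const_mul _
        rw [integral_map hflip.aemeasurable hms.aestronglyMeasurable]
        simp only [mul_comm]
        rfl
    _ = ∫ s, ∫ m, f (s, y m) ∂κ ∂μ :=
        (integral_integral_swap (Integrable.of_bound hH.aestronglyMeasurable 1
          (ae_of_all _ fun p => hf1 _))).symm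
    _ = ∫ s, ∫ ω, f (s, y (M ω)) ∂Q ∂μ := by
        refine integral_congr_ae (ae_of_all _ fun s => ?_)
        have hms : Measurable fun m : χ => f (s, y m) := (hf.comp measurable_prodMk_left).comp hy
        exact integral_map hM.aemeasurable hms.aestronglyMeasurable

/-- `L⁻¹ h ∘ T` is again an admissible test function, the bound by 1 using `L ≥ 1`. -/
theorem abs_integral_comp_sub_le {E : Type*} [NormedAddCommGroup E] [NormedSpace ℝ E]
    [MeasurableSpace E] {Y : Ω → E} {ν : Measure E} [IsProbabilityMeasure ν] {h : E → ℝ}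
    (hh : h ∈ BL1 E) (T : E →L[ℝ] E) {L : ℝ} (hL : 1 ≤ L) (hT : ∀ x, ‖T x‖ ≤ L * ‖x‖) :
    |∫ ω, h (T (Y ω)) ∂Q - ∫ z, h (T z) ∂ν| ≤ L * blDist Q Y ν := by
  have hL0 : 0 < L := by linarith
  have hmem : (fun x => L⁻¹ * h (T x)) ∈ BL1 E := by
    refine ⟨fun x => ?_, fun x y => ?_⟩
    · rw [abs_mul, abs_of_pos (inv_pos.2 hL0)]
      exact mul_le_one₀ (inv_le_one_of_one_le₀ hL) (abs_nonneg _) (hh.1 _)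
    · rw [← mul_sub, abs_mul, abs_of_pos (inv_pos.2 hL0), inv_mul_le_iff₀ hL0]
      refine (hh.2 _ _).trans ?_
      rw [dist_eq_norm, dist_eq_norm, ← map_sub]
      exact hT _
  have h1 := le_blDist (Q := Q) (ν := ν) Y hmem
  rw [integral_const_mul, integral_const_mul, ← mul_sub, abs_mul, abs_of_pos (inv_pos.2 hL0),
    inv_mul_le_iff₀ hL0] at h1
  exact h1

theorem abs_signed_apply_le {U V : Matrix (Fin r) (Fin r) ℝ} (hU : ∀ i j, |U i j| ≤ 1)
    (hV : ∀ i j, |V i j| ≤ 1) (g : Fin r → ℝ) {s : Fin r → ℝ} (hs : ∀ k, s k = 1 ∨ s k = -1)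
    (i j : Fin r) :
    |(U * Matrix.diagonal (fun k => g k * s k) * V.transpose) i j| ≤ ∑ k, |g k| := by
  rw [mul_diagonal_mul_transpose_apply]
  refine (Finset.abs_sum_le_sum_abs _ _).trans (Finset.sum_le_sum fun k _ => ?_)
  have hsk : |s k| = 1 := by rcases hs k with h | h <;> rw [h] <;> norm_num
  rw [abs_mul, abs_mul, abs_mul, hsk, mul_one]
  calc |U i k| * |g k| * |V j k| ≤ 1 * |g k| * 1 :=
        mul_le_mul (mul_le_mul_of_nonneg_right (hU i k) (abs_nonneg _)) (hV j k) (abs_nonneg _)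
          (by positivity)
    _ = |g k| := by ring

/-- The bounded-Lipschitz distance of the sign-corrected, rescaled vector to the target normal
law. -/
theorem blDist_signed_le (hR : IsIIDRademacher Q R) (hM : Measurable M)
    (hRM : IndepFun (fun ω k => R k ω) M Q) {y : χ → EuclideanSpace ℝ (Fin r)}
    (hy : Measurable y) {e : χ → Fin r → ℝ} (hem : ∀ k, Measurable fun m => e m k)
    (he : ∀ m k, e m k = 1 ∨ e m k = -1)
    {S U Sπ Uπ V : Matrix (Fin r) (Fin r) ℝ} {d dπ : Fin r → ℝ}
    (hS : S.PosSemidef) (hU : IsEigenDecomp S U d)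
    (hSπ : Sπ.PosSemidef) (hUπ : IsEigenDecomp Sπ Uπ dπ) (hd : ∀ k, dπ k = 0 → d k = 0)
    (hV : ∀ i j, |V i j| ≤ 1) {c : ℝ} (hVU : ∀ i j, |V i j - U i j| ≤ c) (hc : 0 ≤ c) :
    blDist Q (fun ω => Matrix.toEuclideanCLM (𝕜 := ℝ)
        (V * Matrix.diagonal (fun k => sqrtRatio d dπ k * (R k ω * e (M ω) k)) * Uπ.transpose)
        (y (M ω))) (multivariateGaussian 0 S) ≤
      (r * (r * ∑ k, |sqrtRatio d dπ k|) + 1) *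
        blDist Q (fun ω => y (M ω)) (multivariateGaussian 0 Sπ) +
      r * (r * (c * ∑ k, Real.sqrt (d k))) *
        ∫ x, ‖x‖ ∂(stdGaussian (EuclideanSpace ℝ (Fin r))) := by
  set g := sqrtRatio d dπ with hg
  set L := (r : ℝ) * (r * ∑ k, |g k|) + 1 with hLdef
  have hsum : 0 ≤ ∑ k, |g k| := Finset.sum_nonneg fun k _ => abs_nonneg _
  have hL : 1 ≤ L := le_add_of_nonneg_left (by positivity)
  set μ := Q.map fun ω k => R k ω with hμ
  have hRm : Measurable fun ω k => R k ω := measurable_pi_lambda _ hR.measurable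
  have hμp : IsProbabilityMeasure μ := Measure.isProbabilityMeasure_map hRm.aemeasurable
  have hμs : ∀ᵐ s ∂μ, ∀ k, s k = 1 ∨ s k = -1 := by
    refine ae_all_iff.2 fun k => ?_
    have hset : MeasurableSet {s : Fin r → ℝ | s k = 1 ∨ s k = -1} :=
      (measurableSet_eq_fun (measurable_pi_apply k) measurable_const).union
        (measurableSet_eq_fun (measurable_pi_apply k) measurable_const)
    exact (ae_map_iff hRm.aemeasurable hset).2 (hR.ae_eq k)
  refine blDist_le fun h hh => ?_
  have hcont := continuous_of_mem_BL1 hh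
  set A : (Fin r → ℝ) → Matrix (Fin r) (Fin r) ℝ := fun s =>
    V * Matrix.diagonal (fun k => g k * s k) * Uπ.transpose with hA
  obtain ⟨F, hF, hF1, hFeq⟩ : ∃ F : (Fin r → ℝ) × EuclideanSpace ℝ (Fin r) → ℝ, Measurable F ∧
      (∀ p, |F p| ≤ 1) ∧ ∀ s x, F (s, x) = h (Matrix.toEuclideanCLM (𝕜 := ℝ) (A s) x) :=
    ⟨_, hcont.measurable.comp (continuous_signed_apply V Uπ g).measurable, fun p => hh.1 _,
      fun s x => rfl⟩
  have hint := integral_signed_eq hR hM hRM hy hem he hF hF1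
  -- The intermediate law has covariance `V diag(d) V'`. It is the image of the permutation limit
  -- under every sign vector, so the estimate can be averaged over the signs.
  set c₀ := ∫ z, h z ∂((stdGaussian (EuclideanSpace ℝ (Fin r))).map
    (Matrix.toEuclideanCLM (𝕜 := ℝ) (V * sqrtDiag d))) with hc₀
  have h1 : ∀ s : Fin r → ℝ, (∀ k, s k = 1 ∨ s k = -1) →
      |∫ ω, h (Matrix.toEuclideanCLM (𝕜 := ℝ) (A s) (y (M ω))) ∂Q - c₀| ≤
        L * blDist Q (fun ω => y (M ω)) (multivariateGaussian 0 Sπ) := by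
    intro s hs
    have h2 : ∫ z, h (Matrix.toEuclideanCLM (𝕜 := ℝ) (A s) z) ∂(multivariateGaussian 0 Sπ) = c₀ := by
      rw [hc₀, ← map_multivariateGaussian hSπ hUπ hd V hs,
        integral_map (ContinuousLinearMap.continuous _).measurable.aemeasurable
          hcont.aestronglyMeasurable]
    rw [← h2]
    refine abs_integral_comp_sub_le (Y := fun ω => y (M ω)) hh _ hL fun x => ?_
    refine (norm_toEuclideanCLM_apply_le
      (abs_signed_apply_le hV hUπ.abs_le_one g hs) x).trans ?_
    exact mul_le_mul_of_nonneg_right (by rw [hLdef]; linarith) (norm_nonneg _)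
  have hmeas : StronglyMeasurable fun s : Fin r → ℝ =>
      ∫ ω, h (Matrix.toEuclideanCLM (𝕜 := ℝ) (A s) (y (M ω))) ∂Q := by
    simp only [← hFeq]
    have hj : Measurable fun p : (Fin r → ℝ) × Ω => F (p.1, y (M p.2)) :=
      hF.comp (measurable_fst.prodMk ((hy.comp hM).comp measurable_snd))
    exact StronglyMeasurable.integral_prod_right' hj.stronglyMeasurable
  have hint' : Integrable (fun s : Fin r → ℝ =>
      ∫ ω, h (Matrix.toEuclideanCLM (𝕜 := ℝ) (A s) (y (M ω))) ∂Q) μ :=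
    Integrable.of_bound hmeas.aestronglyMeasurable 1
      (ae_of_all _ fun s => abs_integral_le_one_of_bound fun ω => hh.1 _)
  have h3 : |∫ ω, h (Matrix.toEuclideanCLM (𝕜 := ℝ)
      (A fun k => R k ω * e (M ω) k) (y (M ω))) ∂Q - c₀| ≤
      L * blDist Q (fun ω => y (M ω)) (multivariateGaussian 0 Sπ) := by
    simp only [hFeq] at hint
    rw [hint]
    have h4 : c₀ = ∫ _, c₀ ∂μ := by simp
    rw [h4, ← integral_sub hint' (integrable_const _)]
    have := norm_integral_le_of_norm_le_const (μ := μ)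
      (C := L * blDist Q (fun ω => y (M ω)) (multivariateGaussian 0 Sπ))
      (hμs.mono fun s hs => (Real.norm_eq_abs _).le.trans (h1 s hs))
    simpa using this
  have h5 : |c₀ - ∫ z, h z ∂(multivariateGaussian 0 S)| ≤
      r * (r * (c * ∑ k, Real.sqrt (d k))) *
        ∫ x, ‖x‖ ∂(stdGaussian (EuclideanSpace ℝ (Fin r))) := by
    rw [multivariateGaussian_eq_map hS hU, hc₀]
    refine abs_integral_map_sub_le hh fun i j => ?_
    simp only [sqrtDiag, Matrix.mul_diagonal]
    rw [← sub_mul, abs_mul, abs_of_nonneg (Real.sqrt_nonneg _)]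
    exact mul_le_mul (hVU i j) (Finset.single_le_sum (f := fun k => Real.sqrt (d k))
      (fun k _ => Real.sqrt_nonneg _) (Finset.mem_univ j)) (Real.sqrt_nonneg _) hc
  exact (abs_sub_le _ c₀ _).trans (add_le_add h3 h5)

end ConditionalLaw

/-! ### Inputs of the corrected estimator as nearly measurable maps -/

section Approximation

variable {Ω : Type*} [MeasurableSpace Ω] {r : ℕ}

theorem NearMeasurable.comp_BL1 {E : Type*} [PseudoMetricSpace E] [MeasurableSpace E]
    [BorelSpace E] {P : Measure Ω} {Y : ℕ → Ω → E} (hY : NearMeasurable P Y) {h : E → ℝ}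
    (hh : h ∈ BL1 E) : NearMeasurable P (fun n ω => h (Y n ω)) := by
  intro ε hε
  obtain ⟨V, hV, hVY⟩ := hY ε hε
  refine ⟨fun n ω => h (V n ω),
    fun n => (continuous_of_mem_BL1 hh).measurable.comp (hV n), ?_⟩
  filter_upwards [hVY] with n hn
  exact (measure_mono fun ω hω => le_trans hω (hh.2 _ _)).trans hn

/-- Asymptotic measurability only tests bounded continuous functions; clipping an entry to [-1, 1]
is one, and changes nothing under the bound `hb`. -/
theorem AsympMeasurable.nearMeasurable_entry {P : Measure Ω} [IsProbabilityMeasure P]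
    {V : ℕ → Ω → Matrix (Fin r) (Fin r) ℝ} (h : AsympMeasurable P V)
    (hb : ∀ n ω i j, |V n ω i j| ≤ 1) (i j : Fin r) :
    NearMeasurable P (fun n ω => V n ω i j) := by
  have hbound : ∀ x : ℝ, |max (min x 1) (-1)| ≤ 1 := fun x =>
    abs_le.2 ⟨le_max_right _ _, max_le (min_le_right _ _) (by norm_num)⟩
  have hcont : Continuous fun A : Matrix (Fin r) (Fin r) ℝ => max (min (A i j) 1) (-1) :=
    ((continuous_id.matrix_elem i j).min continuous_const).max continuous_const
  set f : Matrix (Fin r) (Fin r) ℝ →ᵇ ℝ := BoundedContinuousFunction.ofNormedAddCommGroup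
    (fun A => max (min (A i j) 1) (-1)) hcont 1 fun A => hbound _ with hf
  have heq : ∀ n ω, f (V n ω) = V n ω i j := fun n ω => by
    have := abs_le.1 (hb n ω i j)
    change max (min (V n ω i j) 1) (-1) = V n ω i j
    rw [min_eq_left this.2, max_eq_left this.1]
  have := nearMeasurable_of_outerExp (T := fun n ω => f (V n ω)) (fun n ω => hbound _) (h f)
  simpa only [heq] using this

theorem tendsto_measure_compl_of_innerProb {P : Measure Ω} [IsProbabilityMeasure P]
    {A : ℕ → Set Ω} (h : Tendsto (fun n => innerProb P (A n)) atTop (𝓝 1)) :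
    Tendsto (fun n => P (A n)ᶜ) atTop (𝓝 0) := by
  have h1 := ENNReal.Tendsto.sub (tendsto_const_nhds (x := (1 : ℝ≥0∞)) (f := atTop (α := ℕ))) h
    (Or.inl ENNReal.one_ne_top)
  rw [tsub_self] at h1
  refine h1.congr fun n => ?_
  exact ENNReal.sub_sub_cancel ENNReal.one_ne_top prob_le_one

theorem norm_signed_sub_le {U A B : Matrix (Fin r) (Fin r) ℝ} {a b : Fin r → ℝ} {η : ℝ}
    (hU : ∀ i j, |U i j| ≤ 1) (hab : ∀ j k, |a k * A j k - b k * B j k| ≤ η)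
    (y : EuclideanSpace ℝ (Fin r)) :
    dist (Matrix.toEuclideanCLM (𝕜 := ℝ) (U * Matrix.diagonal a * A.transpose) y)
      (Matrix.toEuclideanCLM (𝕜 := ℝ) (U * Matrix.diagonal b * B.transpose) y) ≤
      r * (r * (r * η)) * ‖y‖ := by
  rw [dist_eq_norm, ← sub_apply, ← map_sub]
  refine norm_toEuclideanCLM_apply_le (fun i j => ?_) y
  rw [Matrix.sub_apply, mul_diagonal_mul_transpose_apply, mul_diagonal_mul_transpose_apply,
    ← Finset.sum_sub_distrib]
  refine (Finset.abs_sum_le_sum_abs _ _).trans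
    ((Finset.sum_le_card_nsmul Finset.univ _ η fun k _ => ?_).trans (by simp))
  have : U i k * a k * A j k - U i k * b k * B j k = U i k * (a k * A j k - b k * B j k) := by ring
  rw [this, abs_mul]
  calc |U i k| * |a k * A j k - b k * B j k| ≤ 1 * η :=
        mul_le_mul (hU i k) (hab j k) (abs_nonneg _) zero_le_one
    _ = η := one_mul η

/-- The matrix product of the corrected estimator as a function of its scalar coordinates. -/
noncomputable def coordMap (g : Fin r → ℝ)
    (z : (Fin r × Fin r) ⊕ (Fin r × Fin r) ⊕ Fin r ⊕ Fin r → ℝ) : EuclideanSpace ℝ (Fin r) :=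
  Matrix.toEuclideanCLM (𝕜 := ℝ)
    ((Matrix.of fun i j => z (Sum.inl (i, j))) *
      Matrix.diagonal (fun k => g k * z (Sum.inr (Sum.inr (Sum.inl k)))) *
      (Matrix.of fun i j => z (Sum.inr (Sum.inl (i, j)))).transpose)
    (WithLp.toLp 2 fun k => z (Sum.inr (Sum.inr (Sum.inr k))))

theorem continuous_coordMap (g : Fin r → ℝ) : Continuous (coordMap g) := by
  refine continuous_toEuclideanCLM_apply (Continuous.matrix_mul (Continuous.matrix_mul ?_ ?_) ?_) ?_
  · exact continuous_matrix fun i j => continuous_apply _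
  · exact Continuous.matrix_diagonal (continuous_pi fun k => continuous_const.mul (continuous_apply _))
  · exact Continuous.matrix_transpose (continuous_matrix fun i j => continuous_apply _)
  · exact (PiLp.continuous_toLp 2 _).comp (continuous_pi fun k => continuous_apply _)

end Approximation

end PermCorr

/-! ### The main theorem -/

theorem theorem1
    -- data space and space of the additional randomness (permutation and random signs)
    {Ω₁ Ω₂ : Type*} [MeasurableSpace Ω₁] [MeasurableSpace Ω₂]
    (Q₁ : Measure Ω₁) (Q₂ : Measure Ω₂) [IsProbabilityMeasure Q₁] [IsProbabilityMeasure Q₂]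
    {χ₁ χ₂ : ℕ → Type*} [∀ n, MeasurableSpace (χ₂ n)]
    -- data `X n` (not necessarily measurable) and random permutation `M n`
    (X : ∀ n, Ω₁ → χ₁ n) (M : ∀ n, Ω₂ → χ₂ n) (hM : ∀ n, Measurable (M n))
    (r : ℕ)
    -- limiting covariance matrices, with an eigenvalue decomposition of `Sπ`
    (S Sπ : Matrix (Fin r) (Fin r) ℝ) (hS : S.PosSemidef) (hSπ : Sπ.PosSemidef)
    (Uπ : Matrix (Fin r) (Fin r) ℝ) (dπ : Fin r → ℝ) (hUπ : IsEigenDecomp Sπ Uπ dπ)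
    -- permutation estimator and covariance estimators
    (thetaπ : ∀ n, χ₁ n → χ₂ n → EuclideanSpace ℝ (Fin r))
    (hatS : ∀ n, χ₁ n → Matrix (Fin r) (Fin r) ℝ)
    (hatSπ : ∀ n, χ₁ n → χ₂ n → Matrix (Fin r) (Fin r) ℝ)
    -- eigenvalue decompositions of the covariance estimators
    (hatU : ∀ n, χ₁ n → Matrix (Fin r) (Fin r) ℝ) (hatd : ∀ n, χ₁ n → Fin r → ℝ)
    (hatUπ : ∀ n, χ₁ n → χ₂ n → Matrix (Fin r) (Fin r) ℝ)
    (hatdπ : ∀ n, χ₁ n → χ₂ n → Fin r → ℝ)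
    (hdec : ∀ n x, IsEigenDecomp (hatS n x) (hatU n x) (hatd n x))
    (hdecπ : ∀ n x m, IsEigenDecomp (hatSπ n x m) (hatUπ n x m) (hatdπ n x m))
    -- i.i.d. Rademacher signs, independent of the data (which live on `Ω₁`) and the permutation
    (R : Fin r → Ω₂ → ℝ) (hR : IsIIDRademacher Q₂ R)
    (hRM : ∀ n, IndepFun (fun ω i => R i ω) (M n) Q₂)
    -- measurability in the additional randomness, for fixed data
    (hthetaπ_meas : ∀ n x, Measurable (thetaπ n x))
    (hhatUπ_meas : ∀ n x i j, Measurable (fun m => hatUπ n x m i j))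
    (hcorr_meas : ∀ n x, Measurable (fun ω₂ =>
      corrected (hatU n x) (hatd n x) (hatUπ n x (M n ω₂)) (hatdπ n x (M n ω₂))
        (fun i => R i ω₂) (thetaπ n x (M n ω₂))))
    -- asymptotic normality of the permutation estimator
    (hperm : CondWeakConv Q₁ Q₂
      (fun n ω₁ ω₂ => Real.sqrt n • thetaπ n (X n ω₁) (M n ω₂))
      (multivariateGaussian 0 Sπ))
    -- positive semidefinite and consistent covariance estimators
    (hhatS_psd : ∀ n x, (hatS n x).PosSemidef)
    (hhatSπ_psd : ∀ n x m, (hatSπ n x m).PosSemidef)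
    (hcons : TendstoInMeasure Q₁ (fun n ω₁ => specNorm (hatS n (X n ω₁) - S))
      atTop (fun _ => (0 : ℝ)))
    (hconsπ : TendstoInMeasure (Q₁.prod Q₂)
      (fun n ω => specNorm (hatSπ n (X n ω.1) (M n ω.2) - Sπ)) atTop (fun _ => (0 : ℝ)))
    -- ranks
    (hrank : S.rank ≤ Sπ.rank)
    (hrank_hat : Tendsto (fun n => innerProb (Q₁.prod Q₂)
        {ω | min (hatS n (X n ω.1)).rank (hatSπ n (X n ω.1) (M n ω.2)).rank ≤ Sπ.rank})
      atTop (𝓝 1))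
    -- the positive eigenvalues of `Sπ` are distinct
    (hdistinct : StrictAntiOn dπ {i | (i : ℕ) < Sπ.rank})
    -- asymptotic measurability of the eigenvector estimators
    (hU_asymp : AsympMeasurable Q₁ (fun n ω₁ => hatU n (X n ω₁)))
    (hUπ_asymp : AsympMeasurable (Q₁.prod Q₂)
      (fun n ω => hatUπ n (X n ω.1) (M n ω.2))) :
    CondWeakConv Q₁ Q₂
      (fun n ω₁ ω₂ => Real.sqrt n •
        corrected (hatU n (X n ω₁)) (hatd n (X n ω₁))
          (hatUπ n (X n ω₁) (M n ω₂)) (hatdπ n (X n ω₁) (M n ω₂))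
          (fun i => R i ω₂) (thetaπ n (X n ω₁) (M n ω₂)))
      (multivariateGaussian 0 S) := by
  obtain ⟨U₀, d, hU₀⟩ := exists_isEigenDecomp hS.1
  set g := sqrtRatio d dπ with hg
  set P := Q₁.prod Q₂ with hP
  set y : ∀ n, χ₁ n → χ₂ n → EuclideanSpace ℝ (Fin r) :=
    fun n x m => Real.sqrt n • thetaπ n x m with hy
  have hym : ∀ n x, Measurable (y n x) := fun n x =>
    Measurable.fun_const_smul (hthetaπ_meas n x) (Real.sqrt n)
  set Y : ℕ → Ω₁ → Ω₂ → EuclideanSpace ℝ (Fin r) := fun n ω₁ ω₂ => y n (X n ω₁) (M n ω₂) with hY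
  have hYm : ∀ n ω₁, Measurable (Y n ω₁) := fun n ω₁ => (hym n (X n ω₁)).comp (hM n)
  replace hperm : CondWeakConv Q₁ Q₂ Y (multivariateGaussian 0 Sπ) := hperm
  set e : ∀ n, χ₁ n → χ₂ n → Fin r → ℝ := fun n x m => alignSign Uπ (hatUπ n x m) with he
  have hes : ∀ n x m k, e n x m k = 1 ∨ e n x m k = -1 := fun n x m k => alignSign_eq _ _ k
  have hem : ∀ n x k, Measurable fun m => e n x m k := by
    intro n x k
    refine Measurable.ite (measurableSet_le measurable_const ?_) measurable_const measurable_const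
    exact Finset.measurable_sum _ fun j _ => (hhatUπ_meas n x j k).mul_const _
  -- the corrected estimator, its version with the limiting ratios, and its sign-aligned version
  set W : ℕ → Ω₁ → Ω₂ → EuclideanSpace ℝ (Fin r) := fun n ω₁ ω₂ => Real.sqrt n •
    corrected (hatU n (X n ω₁)) (hatd n (X n ω₁)) (hatUπ n (X n ω₁) (M n ω₂))
      (hatdπ n (X n ω₁) (M n ω₂)) (fun i => R i ω₂) (thetaπ n (X n ω₁) (M n ω₂)) with hW
  set W₀ : ℕ → Ω₁ → Ω₂ → EuclideanSpace ℝ (Fin r) := fun n ω₁ ω₂ =>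
    Matrix.toEuclideanCLM (𝕜 := ℝ) (hatU n (X n ω₁) * Matrix.diagonal (fun k => g k * R k ω₂) *
      (hatUπ n (X n ω₁) (M n ω₂)).transpose) (Y n ω₁ ω₂) with hW₀
  set W₁ : ℕ → Ω₁ → Ω₂ → EuclideanSpace ℝ (Fin r) := fun n ω₁ ω₂ =>
    Matrix.toEuclideanCLM (𝕜 := ℝ) (hatU n (X n ω₁) *
      Matrix.diagonal (fun k => g k * (R k ω₂ * e n (X n ω₁) (M n ω₂) k)) *
      Uπ.transpose) (Y n ω₁ ω₂) with hW₁
  have hWm : ∀ n ω₁, Measurable (W n ω₁) := fun n ω₁ =>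
    Measurable.fun_const_smul (hcorr_meas n (X n ω₁)) (Real.sqrt n)
  have hWeq : ∀ n ω₁ ω₂, W n ω₁ ω₂ = Matrix.toEuclideanCLM (𝕜 := ℝ) (hatU n (X n ω₁) *
      Matrix.diagonal (fun k =>
        sqrtRatio (hatd n (X n ω₁)) (hatdπ n (X n ω₁) (M n ω₂)) k * R k ω₂) *
      (hatUπ n (X n ω₁) (M n ω₂)).transpose) (Y n ω₁ ω₂) := by
    intro n ω₁ ω₂
    simp only [hW, hY, hy]
    rw [corrected_eq, map_smul]
  have hW₁m : ∀ n ω₁, Measurable (W₁ n ω₁) := by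
    intro n ω₁
    exact measurable_signed_apply (hatU n (X n ω₁)) Uπ g (measurable_pi_lambda _ fun k =>
      (hR.measurable k).mul ((hem n (X n ω₁) k).comp (hM n))) (hYm n ω₁)
  have hd : ∀ k, dπ k = 0 → d k = 0 := by
    intro k hk
    refine hU₀.eq_zero hS (hrank.trans (not_lt.1 fun hlt => ?_))
    exact ((hUπ.pos_iff hSπ k).2 hlt).ne' hk
  have hRs : P {p | ¬ ∀ k, R k p.2 = 1 ∨ R k p.2 = -1} = 0 := by
    have h1 : ∀ᵐ ω₂ ∂Q₂, ∀ k, R k ω₂ = 1 ∨ R k ω₂ = -1 := ae_all_iff.2 fun k => hR.ae_eq k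
    have h2 : {p : Ω₁ × Ω₂ | ¬ ∀ k, R k p.2 = 1 ∨ R k p.2 = -1} =
        Set.univ ×ˢ {ω₂ | ¬ ∀ k, R k ω₂ = 1 ∨ R k ω₂ = -1} := by ext; simp
    rw [h2, hP, Measure.prod_prod, ae_iff.1 h1, mul_zero]
  have hcons' : SmallInProb Q₁ (fun n ω₁ => specNorm (hatS n (X n ω₁) - S)) :=
    (tendstoInMeasure_zero_iff.1 hcons).mono fun n ω => le_abs_self _
  have hconsπ' : SmallInProb P (fun n p => specNorm (hatSπ n (X n p.1) (M n p.2) - Sπ)) :=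
    (tendstoInMeasure_zero_iff.1 hconsπ).mono fun n ω => le_abs_self _
  have hrank' := tendsto_measure_compl_of_innerProb hrank_hat
  -- Both comparisons are needed: `W₁` has a tractable conditional law, while `W₀` is a continuous
  -- function of its inputs, which `W₁` is not because the aligning sign jumps.
  have hclose : ∀ ε > 0, ∀ᶠ n in atTop, P {p | ε ≤ dist (W n p.1 p.2) (W₀ n p.1 p.2) ∨
      ε ≤ dist (W n p.1 p.2) (W₁ n p.1 p.2)} ≤ ENNReal.ofReal ε := by
    intro ε hε
    obtain ⟨K, hK1, hK⟩ := hperm.tight hYm (show 0 < ε / 4 by positivity)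
    have hK0 : 0 < K := by linarith
    -- The factor 2 pays for the steps from `W` to `W₀` and from `W₀` to `W₁`; `r³` comes from crude
    -- entrywise matrix bounds, and the 1 makes the final inequality strict.
    set c : ℝ := r * (r * (r * 2)) * K + 1 with hc
    have hc0 : 0 < c := by positivity
    obtain ⟨δ, hδ, hpert⟩ := exists_perturbation_bound hS hSπ hU₀ hUπ hrank hdistinct
      (show 0 < ε / c by positivity)
    have hδ' : 0 < min δ (ε / 4) := by positivity
    filter_upwards [hK, (hcons'.comp_fst (Q₂ := Q₂)) _ hδ', hconsπ' _ hδ',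
      (ENNReal.tendsto_nhds_zero.1 hrank') (ENNReal.ofReal (ε / 4)) (by simpa using by positivity)]
      with n h1 h2 h3 h4
    set B₁ := {p : Ω₁ × Ω₂ | K < ‖Y n p.1 p.2‖} with hB₁
    set B₂ := {p : Ω₁ × Ω₂ | min δ (ε / 4) ≤ specNorm (hatS n (X n p.1) - S)} with hB₂
    set B₃ := {p : Ω₁ × Ω₂ | min δ (ε / 4) ≤ specNorm (hatSπ n (X n p.1) (M n p.2) - Sπ)} with hB₃
    set B₄ := {p : Ω₁ × Ω₂ | min (hatS n (X n p.1)).rank (hatSπ n (X n p.1) (M n p.2)).rank ≤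
      Sπ.rank}ᶜ with hB₄
    set B₅ := {p : Ω₁ × Ω₂ | ¬ ∀ k, R k p.2 = 1 ∨ R k p.2 = -1} with hB₅
    have hsub : {p : Ω₁ × Ω₂ | ε ≤ dist (W n p.1 p.2) (W₀ n p.1 p.2) ∨
        ε ≤ dist (W n p.1 p.2) (W₁ n p.1 p.2)} ⊆ B₁ ∪ B₂ ∪ B₃ ∪ B₄ ∪ B₅ := by
      rintro ⟨ω₁, ω₂⟩ hp
      by_contra hcon
      simp only [Set.mem_union, not_or] at hcon
      obtain ⟨⟨⟨⟨hb1, hb2⟩, hb3⟩, hb4⟩, hb5⟩ := hcon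
      replace hb1 : ‖Y n ω₁ ω₂‖ ≤ K := not_lt.1 hb1
      replace hb2 : specNorm (hatS n (X n ω₁) - S) < δ := lt_of_lt_of_le (not_le.1 hb2) (min_le_left _ _)
      replace hb3 : specNorm (hatSπ n (X n ω₁) (M n ω₂) - Sπ) < δ :=
        lt_of_lt_of_le (not_le.1 hb3) (min_le_left _ _)
      replace hb4 : min (hatS n (X n ω₁)).rank (hatSπ n (X n ω₁) (M n ω₂)).rank ≤ Sπ.rank :=
        Set.notMem_compl_iff.1 hb4
      replace hb5 : ∀ k, R k ω₂ = 1 ∨ R k ω₂ = -1 := not_not.1 hb5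
      obtain ⟨hp1, hp2⟩ := hpert _ _ _ _ _ _ (hhatS_psd n (X n ω₁))
        (hhatSπ_psd n (X n ω₁) (M n ω₂)) (hdec n (X n ω₁)) (hdecπ n (X n ω₁) (M n ω₂))
        (fun i j => (abs_apply_le_specNorm (hatS n (X n ω₁) - S) i j).trans_lt hb2)
        (fun i j => (abs_apply_le_specNorm (hatSπ n (X n ω₁) (M n ω₂) - Sπ) i j).trans_lt hb3) hb4
      have hRabs : ∀ k, |R k ω₂| = 1 := fun k => by
        rcases hb5 k with h | h <;> rw [h] <;> norm_num
      have hεc : 0 < ε / c := by positivity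
      have hU1 := (hdec n (X n ω₁)).abs_le_one
      have hUπ1 := (hdecπ n (X n ω₁) (M n ω₂)).abs_le_one
      have hent : ∀ j k, |sqrtRatio (hatd n (X n ω₁)) (hatdπ n (X n ω₁) (M n ω₂)) k * R k ω₂ *
          hatUπ n (X n ω₁) (M n ω₂) j k - g k * R k ω₂ * hatUπ n (X n ω₁) (M n ω₂) j k| ≤ ε / c := by
        intro j k
        rw [← sub_mul, ← sub_mul, abs_mul, abs_mul, hRabs, mul_one]
        calc _ ≤ ε / c * 1 := mul_le_mul (hp1 k).le (hUπ1 j k) (abs_nonneg _) hεc.le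
          _ = ε / c := mul_one _
      have hent' : ∀ j k, |g k * R k ω₂ * hatUπ n (X n ω₁) (M n ω₂) j k -
          g k * (R k ω₂ * e n (X n ω₁) (M n ω₂) k) * Uπ j k| ≤ ε / c := by
        intro j k
        have : g k * R k ω₂ * hatUπ n (X n ω₁) (M n ω₂) j k -
            g k * (R k ω₂ * e n (X n ω₁) (M n ω₂) k) * Uπ j k =
            R k ω₂ * (g k * (hatUπ n (X n ω₁) (M n ω₂) j k -
              e n (X n ω₁) (M n ω₂) k * Uπ j k)) := by ring
        rw [this, abs_mul, hRabs, one_mul]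
        exact (hp2 j k).le
      have hfin : ∀ a : ℝ, a ≤ r * (r * (r * (2 * (ε / c)))) * ‖Y n ω₁ ω₂‖ → a < ε := by
        intro a ha
        calc a ≤ r * (r * (r * (2 * (ε / c)))) * K :=
              ha.trans (mul_le_mul_of_nonneg_left hb1 (by positivity))
          _ = (r * (r * (r * 2)) * K) * (ε / c) := by ring
          _ < c * (ε / c) := mul_lt_mul_of_pos_right (by rw [hc]; linarith) hεc
          _ = ε := mul_div_cancel₀ _ hc0.ne'
      have hd0 : dist (W n ω₁ ω₂) (W₀ n ω₁ ω₂) < ε := by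
        refine hfin _ ?_
        rw [hWeq]
        exact norm_signed_sub_le hU1 (fun j k => (hent j k).trans (by linarith)) _
      have hd1 : dist (W n ω₁ ω₂) (W₁ n ω₁ ω₂) < ε := by
        refine hfin _ ?_
        rw [hWeq]
        refine norm_signed_sub_le hU1 (fun j k => (abs_sub_le _ _ _).trans
          ((add_le_add (hent j k) (hent' j k)).trans (by linarith))) _
      rcases hp with hp | hp
      · exact absurd hd0 (not_lt.2 hp)
      · exact absurd hd1 (not_lt.2 hp)
    have hmin : ENNReal.ofReal (min δ (ε / 4)) ≤ ENNReal.ofReal (ε / 4) :=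
      ENNReal.ofReal_le_ofReal (min_le_right _ _)
    calc P {p : Ω₁ × Ω₂ | ε ≤ dist (W n p.1 p.2) (W₀ n p.1 p.2) ∨
          ε ≤ dist (W n p.1 p.2) (W₁ n p.1 p.2)}
        ≤ P B₁ + P B₂ + P B₃ + P B₄ + P B₅ := by
          refine (measure_mono hsub).trans ?_
          refine (measure_union_le _ _).trans (add_le_add_left ?_ _)
          refine (measure_union_le _ _).trans (add_le_add_left ?_ _)
          refine (measure_union_le _ _).trans (add_le_add_left ?_ _)
          exact measure_union_le _ _
      _ ≤ ENNReal.ofReal (ε / 4) + ENNReal.ofReal (ε / 4) + ENNReal.ofReal (ε / 4) +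
          ENNReal.ofReal (ε / 4) + 0 :=
          add_le_add (add_le_add (add_le_add (add_le_add h1 (h2.trans hmin)) (h3.trans hmin)) h4)
            hRs.le
      _ = ENNReal.ofReal ε := by
          rw [add_zero, ← ENNReal.ofReal_add (by positivity) (by positivity),
            ← ENNReal.ofReal_add (by positivity) (by positivity),
            ← ENNReal.ofReal_add (by positivity) (by positivity)]
          congr 1; ring
  have hclose₀ : SmallInProb P (fun n p => dist (W n p.1 p.2) (W₀ n p.1 p.2)) := fun ε hε =>
    (hclose ε hε).mono fun n hn => (measure_mono fun p hp => Or.inl hp).trans hn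
  have hclose₁ : SmallInProb P (fun n p => dist (W n p.1 p.2) (W₁ n p.1 p.2)) := fun ε hε =>
    (hclose ε hε).mono fun n hn => (measure_mono fun p hp => Or.inr hp).trans hn
  have hW₁conv : SmallInProb Q₁
      (fun n ω₁ => blDist Q₂ (W₁ n ω₁) (multivariateGaussian 0 S)) := by
    intro ε hε
    set L : ℝ := r * (r * ∑ k, |g k|) + 1 with hL
    have hL0 : 0 < L := by
      have : 0 ≤ ∑ k, |g k| := Finset.sum_nonneg fun k _ => abs_nonneg _
      positivity
    set m : ℝ := r * r * (∑ k, Real.sqrt (d k)) *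
      ∫ x, ‖x‖ ∂(stdGaussian (EuclideanSpace ℝ (Fin r))) with hm
    have hm0 : 0 ≤ m := by
      have h1 : 0 ≤ ∑ k, Real.sqrt (d k) := Finset.sum_nonneg fun k _ => Real.sqrt_nonneg _
      have h2 : 0 ≤ ∫ x, ‖x‖ ∂(stdGaussian (EuclideanSpace ℝ (Fin r))) :=
        integral_nonneg fun x => norm_nonneg x
      positivity
    -- Chosen so that replacing the estimated eigenvectors by true ones costs `c * m < ε / 2`.
    set c : ℝ := ε / 2 / (m + 1) with hc
    have hc0 : 0 < c := by positivity
    have hcm : c * m < ε / 2 := by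
      rw [hc, div_mul_eq_mul_div, div_lt_iff₀ (by positivity)]
      nlinarith
    obtain ⟨δ, hδ, hnear⟩ := exists_isEigenDecomp_near S hc0
    filter_upwards [hcons' (min δ (ε / 2)) (by positivity),
      (condWeakConv_iff.1 hperm).1 (min (ε / (2 * L)) (ε / 2)) (by positivity)] with n h1 h2
    calc Q₁ {ω₁ | ε ≤ blDist Q₂ (W₁ n ω₁) (multivariateGaussian 0 S)}
        ≤ Q₁ ({ω₁ | min δ (ε / 2) ≤ specNorm (hatS n (X n ω₁) - S)} ∪
            {ω₁ | min (ε / (2 * L)) (ε / 2) ≤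
              blDist Q₂ (Y n ω₁) (multivariateGaussian 0 Sπ)}) := by
          refine measure_mono fun ω₁ hω => ?_
          by_contra hcon
          simp only [Set.mem_union, Set.mem_ofPred_eq, not_or, not_le] at hcon hω
          obtain ⟨hb1, hb2⟩ := hcon
          -- The eigenvector matrix `U` of `S` is chosen anew for each value of the data and each
          -- `n`; only its eigenvalues `d` are fixed.
          obtain ⟨U, d', hU, hUc, -⟩ := hnear _ _ _ (hdec n (X n ω₁)) fun i j =>
            ((abs_apply_le_specNorm (hatS n (X n ω₁) - S) i j).trans_lt hb1).trans_le
              (min_le_left _ _)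
          obtain rfl := hU₀.eigenvalues_unique hU
          have hbl := blDist_signed_le hR (hM n) (hRM n) (hym n (X n ω₁)) (hem n (X n ω₁))
            (hes n (X n ω₁)) hS hU hSπ hUπ hd (hdec n (X n ω₁)).abs_le_one
            (fun i j => (hUc i j).le) hc0.le
          replace hbl : blDist Q₂ (W₁ n ω₁) (multivariateGaussian 0 S) ≤
              L * blDist Q₂ (Y n ω₁) (multivariateGaussian 0 Sπ) +
              r * (r * (c * ∑ k, Real.sqrt (d k))) *
                ∫ x, ‖x‖ ∂(stdGaussian (EuclideanSpace ℝ (Fin r))) := hbl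
          have heq : r * (r * (c * ∑ k, Real.sqrt (d k))) *
              ∫ x, ‖x‖ ∂(stdGaussian (EuclideanSpace ℝ (Fin r))) = c * m := by rw [hm]; ring
          have hb3 : L * blDist Q₂ (Y n ω₁) (multivariateGaussian 0 Sπ) < L * (ε / (2 * L)) :=
            mul_lt_mul_of_pos_left (hb2.trans_le (min_le_left _ _)) hL0
          have hb4 : L * (ε / (2 * L)) = ε / 2 := by field_simp
          rw [heq] at hbl
          linarith
      _ ≤ ENNReal.ofReal (ε / 2) + ENNReal.ofReal (ε / 2) :=
          (measure_union_le _ _).trans (add_le_add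
            (h1.trans (ENNReal.ofReal_le_ofReal (min_le_right _ _)))
            (h2.trans (ENNReal.ofReal_le_ofReal (min_le_right _ _))))
      _ = ENNReal.ofReal ε := by
          rw [← ENNReal.ofReal_add (by positivity) (by positivity), add_halves]
  set z : ℕ → Ω₁ × Ω₂ → (Fin r × Fin r) ⊕ (Fin r × Fin r) ⊕ Fin r ⊕ Fin r → ℝ := fun n p =>
    Sum.elim (fun ij => hatU n (X n p.1) ij.1 ij.2)
      (Sum.elim (fun ij => hatUπ n (X n p.1) (M n p.2) ij.1 ij.2)
        (Sum.elim (fun k => R k p.2) (fun k => Y n p.1 p.2 k))) with hz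
  have hznear : NearMeasurable P z := by
    refine NearMeasurable.pi ?_
    rintro (⟨i, j⟩ | ⟨i, j⟩ | k | k)
    · exact (hU_asymp.nearMeasurable_entry
        (fun n ω₁ => (hdec n (X n ω₁)).abs_le_one) i j).comp_fst
    · exact hUπ_asymp.nearMeasurable_entry
        (fun n p => (hdecπ n (X n p.1) (M n p.2)).abs_le_one) i j
    · exact NearMeasurable.of_measurable fun n => (hR.measurable k).comp measurable_snd
    · refine hperm.nearMeasurable_comp hYm (φ := fun x => x k) (fun x y => ?_) fun x => ?_
      · have := PiLp.norm_apply_le (x - y) k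
        rwa [← dist_eq_norm] at this
      · exact PiLp.norm_apply_le x k
  have hW₀near : NearMeasurable P (fun n p => W₀ n p.1 p.2) := by
    refine NearMeasurable.comp_continuous (f := coordMap g) hznear (continuous_coordMap g) ?_
    intro ε hε
    obtain ⟨K, hK1, hK⟩ := hperm.tight hYm hε
    -- Since `K ≥ 1`, this cube contains all eigenvector entries and signs ±1; only the coordinates
    -- of `Y` can leave it, up to a null set.
    refine ⟨Set.univ.pi fun _ => Set.Icc (-K) K, isCompact_univ_pi fun _ => isCompact_Icc, ?_⟩
    filter_upwards [hK] with n hn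
    calc P {p | z n p ∉ Set.univ.pi fun _ => Set.Icc (-K) K}
        ≤ P ({p | K < ‖Y n p.1 p.2‖} ∪ {p | ¬ ∀ k, R k p.2 = 1 ∨ R k p.2 = -1}) := by
          refine measure_mono fun p hp => ?_
          by_contra hcon
          simp only [Set.mem_union, Set.mem_ofPred_eq, not_or, not_lt, not_not] at hcon
          refine hp fun i _ => abs_le.1 ?_
          rcases i with ⟨i, j⟩ | ⟨i, j⟩ | k | k
          · exact ((hdec n (X n p.1)).abs_le_one i j).trans hK1
          · exact ((hdecπ n (X n p.1) (M n p.2)).abs_le_one i j).trans hK1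
          · refine le_trans (le_of_eq ?_) hK1
            change |R k p.2| = 1
            rcases hcon.2 k with h | h <;> rw [h] <;> norm_num
          · exact (PiLp.norm_apply_le (Y n p.1 p.2) k).trans hcon.1
      _ ≤ ENNReal.ofReal ε := by
          refine (measure_union_le _ _).trans ?_
          rw [hRs, add_zero]
          exact hn
  rw [condWeakConv_iff]
  exact ⟨SmallInProb.blDist_of_close hWm hW₁m hclose₁ hW₁conv,
    fun h hh => (hW₀near.of_close hclose₀).comp_BL1 hh⟩
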